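/- Let $\mathscr G$ be a (non-empty) ample groupoid, i.e. a topological groupoid whose unit space $\mathscr G^{(0)}$ is Hausdorff, locally compact and has a basis of compact open sets, and whose range map $r$ is a local homeomorphism onto $\mathscr G^{(0)}$; write $d$ for the source map. The arrow space itself need not be Hausdorff. A bisection is a set of arrows on which $d$ and $r$ are injective. Let $\mathcal O$ be a $\mathscr G$-sheaf of fields: a local homeomorphism $p\colon E\to\mathscr G^{(0)}$ whose stalks $\mathcal O_x=p^{-1}(x)$ are fields, with fibrewise addition and multiplication continuous and $x\mapsto 1_x$ continuous, together with a continuous action $(\gamma,e)\mapsto\alpha_\gamma(e)$, defined for $d(\gamma)=p(e)$, by unital ring homomorphisms $\alpha_\gamma\colon\mathcal O_{d(\gamma)}\to\mathcal O_{r(\gamma)}$ such that $\alpha_x=\mathrm{id}$ for units $x$ and $\alpha_\beta\alpha_\gamma=\alpha_{\beta\gamma}$ whenever $\beta\gamma$ is defined. For an open subgroupoid $\mathscr H$ of $\mathscr G$, let $\Gamma_c(\mathscr H,\mathcal O)$ be the additive group generated by the maps $f\colon\mathscr G\to E$ with $p\circ f=r$ for which there is a compact open bisection $U\subseteq\mathscr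 H$ such that $f$ is continuous on $U$ and zero outside $U$. The group $\Gamma_c(\mathscr G,\mathcal O)$ is a ring under the convolution $(f*g)(\gamma)=\sum_{\beta\rho=\gamma}f(\beta)\,\alpha_\beta(g(\rho))$. The ring $\Gamma_c(\mathscr G^{(0)},\mathcal O)$ of compactly supported continuous sections over $\mathscr G^{(0)}$, with pointwise operations, is a subring of it via extension by zero. Put $\operatorname{supp} f=\{\gamma: f(\gamma)\ne 0\}$, $\ker\mathcal O=\{\gamma : d(\gamma)=r(\gamma),\ \alpha_\gamma=\mathrm{id}\}$, and let $\operatorname{Int}$ denote the interior in the arrow space. The groupoid $\mathscr G$ is minimal if $\emptyset$ and $\mathscr G^{(0)}$ are the only open subsets $V$ of $\mathscr G^{(0)}$ such that $d(\gamma)\in V$ implies $r(\gamma)\in V$ for every arrow $\gamma$. Let $\mathscr G^a$ be the inverse semigroup of compact open bisections. Each $U\in\mathscr G^a$ defines an isomorphism $\tilde\alpha_U$ from the ideal of sections in $\Gamma_c(\mathscr G^{(0)},\mathcal O)$ that vanish outside $d(U)$ to the ideal of those that vanish outside $r(U)$, by $\tilde\alpha_U(s)(r(\gamma))=\alpha_\gamma(s(d(\gamma)))$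 for $\gamma\in U$. An ideal $I$ is $\mathscr G^a$-invariant if $\tilde\alpha_U(s)\in I$ for all $U\in\mathscr G^a$ and all $s\in I$ vanishing outside $d(U)$. The ring $\Gamma_c(\mathscr G^{(0)},\mathcal O)$ is $\mathscr G^a$-simple if $0$ and the whole ring are its only $\mathscr G^a$-invariant ideals. Then the following are equivalent: 1. $\Gamma_c(\mathscr G,\mathcal O)$ is simple; 2. $\Gamma_c(\mathscr G^{(0)},\mathcal O)$ is $\mathscr G^a$-simple and a maximal commutative subring of $\Gamma_c(\mathscr G,\mathcal O)$; 3. $\mathscr G$ is minimal, $\operatorname{Int}(\ker\mathcal O)=\mathscr G^{(0)}$, and $\Gamma_c(\operatorname{Int}(\ker\mathcal O),\mathcal O)=\{f\in\Gamma_c(\mathscr G,\mathcal O) : \operatorname{supp}(f)\subseteq\ker\mathcal O\}$. If moreover $\mathscr G$ is Hausdorff, these are also equivalent to: 4. $\mathscr G$ is minimal and $\operatorname{Int}(\ker\mathcal O)=\mathscr G^{(0)}$. -/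

import Mathlib

open CategoryTheory Topology TopologicalSpace

universe w v u

/-! ### Ample groupoids

A groupoid is Mathlib's `Groupoid` on a type `X` of units; its arrow space is `Quiver.Total X`.
For `γ : Quiver.Total X`, the source is `γ.left`, the range is `γ.right`; the product `βρ` of arrows
with source of `β` equal to the range of `ρ` is `ρ ≫ β`. -/

/-- A pair `(β, ρ)` of arrows such that the product `βρ` is defined. -/
structure ComposablePair (X : Type u) [Groupoid.{v} X] where
  {x y z : X}
  outer : y ⟶ z
  inner : x ⟶ y

namespace ComposablePair

variable {X : Type u} [Groupoid.{v} X]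

/-- The inclusion of the composable pairs in the square of the arrow space. -/
def toProd (q : ComposablePair X) : Quiver.Total X × Quiver.Total X :=
  (⟨q.y, q.z, q.outer⟩, ⟨q.x, q.y, q.inner⟩)

/-- The product `βρ`. -/
def mul (q : ComposablePair X) : Quiver.Total X := ⟨q.x, q.z, q.inner ≫ q.outer⟩

/-- Composable pairs carry the subspace topology of the product topology. -/
instance [TopologicalSpace (Quiver.Total X)] : TopologicalSpace (ComposablePair X) :=
  TopologicalSpace.induced toProd inferInstance

end ComposablePair

/-- An ample groupoid: a topological groupoid with locally compact Hausdorff unit space, whose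
range map is a local homeomorphism and whose unit space has a basis of compact open sets.
The topology of `X` is the one of the unit space, that is, the inclusion of the units in the arrow
space is continuous (hence a homeomorphism onto its image, the source map being continuous). -/
class AmpleGroupoid (X : Type u) [Groupoid.{v} X] [TopologicalSpace X]
    [TopologicalSpace (Quiver.Total X)] : Prop where
  continuous_source : Continuous fun γ : Quiver.Total X => γ.left
  continuous_range : Continuous fun γ : Quiver.Total X => γ.right
  continuous_unit : Continuous fun x : X => (⟨x, x, 𝟙 x⟩ : Quiver.Total X)
  continuous_inv : Continuous fun γ : Quiver.Total X =>
    (⟨γ.right, γ.left, Groupoid.inv γ.hom⟩ : Quiver.Total X)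
  continuous_mul : Continuous (ComposablePair.mul : ComposablePair X → Quiver.Total X)
  t2 : T2Space X
  locallyCompact : LocallyCompactSpace X
  isLocalHomeomorph_range : IsLocalHomeomorph fun γ : Quiver.Total X => γ.right
  isTopologicalBasis : IsTopologicalBasis {U : Set X | IsOpen U ∧ IsCompact U}

section Groupoid

variable (X : Type u) [Groupoid.{v} X]

/-- The set of units, inside the arrow space. -/
def unitArrows : Set (Quiver.Total X) := Set.range fun x : X => ⟨x, x, 𝟙 x⟩

/-- A groupoid is minimal if the only open invariant subsets of the unit space are the trivial
ones. -/
def IsMinimalGroupoid [TopologicalSpace X] : Prop :=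
  ∀ U : Set X, IsOpen U → (∀ γ : Quiver.Total X, γ.left ∈ U → γ.right ∈ U) →
    U = ∅ ∨ U = Set.univ

variable {X}

/-- Compact open bisections. (The source and range maps are injective on such a set; as the unit
space of an ample groupoid is Hausdorff, such a set is automatically a Hausdorff subspace.) -/
structure IsCompactOpenBisection [TopologicalSpace (Quiver.Total X)] (U : Set (Quiver.Total X)) :
    Prop where
  isOpen : IsOpen U
  isCompact : IsCompact U
  source_injOn : Set.InjOn (fun γ : Quiver.Total X => γ.left) U
  range_injOn : Set.InjOn (fun γ : Quiver.Total X => γ.right) U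

end Groupoid

/-! ### Sheaves of rings over a groupoid -/

/-- Pairs of elements in the same stalk, i.e. the pullback `E ×_{p,p} E`, where
`E = Σ x, S x` and `p : E → X` is the projection. -/
structure FiberPair {X : Type u} (S : X → Type w) where
  pt : X
  fst : S pt
  snd : S pt

/-- Pairs `(γ, e)` with `e` in the stalk at the source of `γ`. -/
structure ActionPair {X : Type u} [Groupoid.{v} X] (S : X → Type w) where
  arrow : Quiver.Total X
  val : S arrow.left

namespace FiberPair

variable {X : Type u} {S : X → Type w}

/-- The inclusion in `E × E`. -/
def toProd (q : FiberPair S) : (Σ x, S x) × (Σ x, S x) := (⟨q.pt, q.fst⟩, ⟨q.pt, q.snd⟩)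

instance [TopologicalSpace (Σ x, S x)] : TopologicalSpace (FiberPair S) :=
  TopologicalSpace.induced toProd inferInstance

end FiberPair

namespace ActionPair

variable {X : Type u} [Groupoid.{v} X] {S : X → Type w}

/-- The inclusion in the product of the arrow space and `E`. -/
def toProd (q : ActionPair S) : Quiver.Total X × (Σ x, S x) := (q.arrow, ⟨q.arrow.left, q.val⟩)

instance [TopologicalSpace (Quiver.Total X)] [TopologicalSpace (Σ x, S x)] :
    TopologicalSpace (ActionPair S) :=
  TopologicalSpace.induced toProd inferInstance

end ActionPair

/-- A sheaf of unital rings over a topological groupoid, presented by its family of stalks and a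
topology on the total space `E = Σ x, stalk x`. -/
structure GroupoidSheafOfRings (X : Type u) [Groupoid.{v} X] [TopologicalSpace X]
    [TopologicalSpace (Quiver.Total X)] where
  stalk : X → Type w
  [ring : ∀ x, Ring (stalk x)]
  [top : TopologicalSpace (Σ x, stalk x)]
  isLocalHomeomorph_proj : IsLocalHomeomorph (Sigma.fst : (Σ x, stalk x) → X)
  /-- The action of an arrow, a unital ring homomorphism between stalks. -/
  act : ∀ {x y : X}, (x ⟶ y) → stalk x →+* stalk y
  act_id : ∀ (x : X) (a : stalk x), act (𝟙 x) a = a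
  act_comp : ∀ {x y z : X} (ρ : x ⟶ y) (β : y ⟶ z) (a : stalk x),
    act (ρ ≫ β) a = act β (act ρ a)
  continuous_act : Continuous fun q : ActionPair stalk =>
    (⟨q.arrow.right, act q.arrow.hom q.val⟩ : Σ x, stalk x)
  continuous_add : Continuous fun q : FiberPair stalk => (⟨q.pt, q.fst + q.snd⟩ : Σ x, stalk x)
  continuous_mul : Continuous fun q : FiberPair stalk => (⟨q.pt, q.fst * q.snd⟩ : Σ x, stalk x)
  continuous_one : Continuous fun x : X => (⟨x, 1⟩ : Σ x, stalk x)

namespace GroupoidSheafOfRings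

attribute [instance] ring top

variable {X : Type u} [Groupoid.{v} X] [TopologicalSpace X] [TopologicalSpace (Quiver.Total X)]

/-- A sheaf of fields: every stalk is a (commutative) field. -/
def IsSheafOfFields (O : GroupoidSheafOfRings.{w} X) : Prop := ∀ x, IsField (O.stalk x)

/-- The kernel: the isotropy arrows that act trivially. -/
def ker (O : GroupoidSheafOfRings.{w} X) : Set (Quiver.Total X) :=
  {γ | ∃ (x : X) (g : x ⟶ x), γ = ⟨x, x, g⟩ ∧ ∀ a : O.stalk x, O.act g a = a}

/-- The support of a map assigning to each arrow an element of the stalk at its range. -/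
def supp (O : GroupoidSheafOfRings.{w} X) (f : ∀ γ : Quiver.Total X, O.stalk γ.right) :
    Set (Quiver.Total X) := {γ | f γ ≠ 0}

/-- The maps `f` that are continuous on, and vanish outside of, the set `U`. -/
def SupportedOn (O : GroupoidSheafOfRings.{w} X) (f : ∀ γ : Quiver.Total X, O.stalk γ.right)
    (U : Set (Quiver.Total X)) : Prop :=
  ContinuousOn (fun γ => (⟨γ.right, f γ⟩ : Σ x, O.stalk x)) U ∧ ∀ γ ∉ U, f γ = 0

/-- For an open set `H` of arrows (in particular for an open subgroupoid `H`), the additive group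
`Γ_c(H, O)`, generated by the maps supported on a compact open bisection contained in `H`. -/
def sectionsIn (O : GroupoidSheafOfRings.{w} X) (H : Set (Quiver.Total X)) :
    AddSubgroup (∀ γ : Quiver.Total X, O.stalk γ.right) :=
  AddSubgroup.closure {f | ∃ U, IsCompactOpenBisection U ∧ U ⊆ H ∧ O.SupportedOn f U}

/-- The convolution algebra `Γ_c(G, O)`, as an additive group. -/
def convAlgebra (O : GroupoidSheafOfRings.{w} X) :
    AddSubgroup (∀ γ : Quiver.Total X, O.stalk γ.right) :=
  O.sectionsIn Set.univ

/-- The convolution `(f * g)(γ) = ∑_{βρ = γ} f(β) α_β(g(ρ))`. The factorizations `γ = βρ` are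
indexed by the arrows `β` with the same range as `γ`, and `ρ = β⁻¹γ`. -/
noncomputable def conv (O : GroupoidSheafOfRings.{w} X)
    (f g : ∀ γ : Quiver.Total X, O.stalk γ.right) (γ : Quiver.Total X) : O.stalk γ.right :=
  ∑ᶠ β : Σ z : X, z ⟶ γ.right,
    f ⟨β.1, γ.right, β.2⟩ * O.act β.2 (g ⟨γ.left, β.1, γ.hom ≫ Groupoid.inv β.2⟩)

/-! ### The convolution product on `Γ_c(G, O)` -/

lemma finite_fiber (O : GroupoidSheafOfRings.{w} X) {f : ∀ γ : Quiver.Total X, O.stalk γ.right}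
    (hf : f ∈ O.convAlgebra) (y : X) :
    {β : Σ z : X, z ⟶ y | f ⟨β.1, y, β.2⟩ ≠ 0}.Finite := by
  induction hf using AddSubgroup.closure_induction with
  | mem f hf =>
    obtain ⟨U, hU, -, hf⟩ := hf
    apply Set.Subsingleton.finite
    rintro ⟨z, β⟩ hβ ⟨z', β'⟩ hβ'
    have h1 : (⟨z, y, β⟩ : Quiver.Total X) ∈ U := by
      by_contra h; exact hβ (hf.2 _ h)
    have h2 : (⟨z', y, β'⟩ : Quiver.Total X) ∈ U := by
      by_contra h; exact hβ' (hf.2 _ h)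
    have := hU.range_injOn h1 h2 rfl
    simp only [Quiver.Total.mk.injEq] at this
    obtain ⟨rfl, -, h⟩ := this
    rw [eq_of_heq h]
  | zero => simp
  | add f g _ _ hf hg =>
    refine (hf.union hg).subset ?_
    intro β hβ
    by_contra h
    simp only [Set.mem_union, Set.mem_ofPred_eq, not_or, not_not] at h
    exact hβ (by simp [h.1, h.2])
  | neg f _ hf => simpa using hf

lemma hasFiniteSupport_conv (O : GroupoidSheafOfRings.{w} X)
    {f : ∀ γ : Quiver.Total X, O.stalk γ.right} (hf : f ∈ O.convAlgebra)
    (y : X) (k : (Σ z : X, z ⟶ y) → O.stalk y) :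
    Function.HasFiniteSupport (M := O.stalk y)
      (fun β : Σ z : X, z ⟶ y => f ⟨β.1, y, β.2⟩ * k β) := by
  refine (O.finite_fiber hf y).subset ?_
  intro β hβ h
  exact hβ (by simp [h])

lemma conv_add (O : GroupoidSheafOfRings.{w} X) {f : ∀ γ : Quiver.Total X, O.stalk γ.right}
    (hf : f ∈ O.convAlgebra) (g h : ∀ γ : Quiver.Total X, O.stalk γ.right) :
    O.conv f (g + h) = O.conv f g + O.conv f h := by
  funext γ
  simp only [conv, Pi.add_apply, map_add, mul_add]
  exact finsum_add_distrib (O.hasFiniteSupport_conv hf _ _) (O.hasFiniteSupport_conv hf _ _)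

lemma add_conv (O : GroupoidSheafOfRings.{w} X) {f g : ∀ γ : Quiver.Total X, O.stalk γ.right}
    (hf : f ∈ O.convAlgebra) (hg : g ∈ O.convAlgebra)
    (h : ∀ γ : Quiver.Total X, O.stalk γ.right) :
    O.conv (f + g) h = O.conv f h + O.conv g h := by
  funext γ
  simp only [conv, Pi.add_apply, add_mul]
  exact finsum_add_distrib (O.hasFiniteSupport_conv hf _ _) (O.hasFiniteSupport_conv hg _ _)

lemma conv_zero (O : GroupoidSheafOfRings.{w} X) (f : ∀ γ : Quiver.Total X, O.stalk γ.right) :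
    O.conv f 0 = 0 := by
  funext γ
  simp [conv]

lemma zero_conv (O : GroupoidSheafOfRings.{w} X) (f : ∀ γ : Quiver.Total X, O.stalk γ.right) :
    O.conv 0 f = 0 := by
  funext γ
  simp [conv]

lemma conv_neg (O : GroupoidSheafOfRings.{w} X) (f g : ∀ γ : Quiver.Total X, O.stalk γ.right) :
    O.conv f (-g) = -O.conv f g := by
  funext γ
  simp [conv, finsum_neg_distrib]

lemma neg_conv (O : GroupoidSheafOfRings.{w} X) (f g : ∀ γ : Quiver.Total X, O.stalk γ.right) :
    O.conv (-f) g = -O.conv f g := by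
  funext γ
  simp [conv, finsum_neg_distrib]

/-- If `δ` is the only arrow with range `y` at which `f` may be nonzero, then the convolution sum
reduces to one term. -/
lemma conv_apply_of_unique (O : GroupoidSheafOfRings.{w} X)
    (f g : ∀ γ : Quiver.Total X, O.stalk γ.right) {x y z : X} (δ : z ⟶ y)
    (hδ : ∀ β : Σ z : X, z ⟶ y, β ≠ ⟨z, δ⟩ → f ⟨β.1, y, β.2⟩ = 0) (γ : x ⟶ y) :
    O.conv f g ⟨x, y, γ⟩ = f ⟨z, y, δ⟩ * O.act δ (g ⟨x, z, γ ≫ Groupoid.inv δ⟩) := by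
  refine finsum_eq_single _ (⟨z, δ⟩ : Σ z : X, z ⟶ y) ?_
  intro β hβ
  simp [hδ β hβ]

lemma SupportedOn.eq_zero_of_ne {O : GroupoidSheafOfRings.{w} X}
    {f : ∀ γ : Quiver.Total X, O.stalk γ.right} {U : Set (Quiver.Total X)}
    (hU : IsCompactOpenBisection U) (hf : O.SupportedOn f U) {y z : X} {δ : z ⟶ y}
    (hδ : ⟨z, y, δ⟩ ∈ U) (β : Σ z : X, z ⟶ y) (hβ : β ≠ ⟨z, δ⟩) :
    f ⟨β.1, y, β.2⟩ = 0 := by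
  apply hf.2
  intro h
  apply hβ
  have := hU.range_injOn h hδ rfl
  obtain ⟨z', β⟩ := β
  simp only [Quiver.Total.mk.injEq] at this
  obtain ⟨rfl, -, h⟩ := this
  rw [eq_of_heq h]

lemma SupportedOn.exists_unique {O : GroupoidSheafOfRings.{w} X}
    {f : ∀ γ : Quiver.Total X, O.stalk γ.right} {U : Set (Quiver.Total X)}
    (hU : IsCompactOpenBisection U) (hf : O.SupportedOn f U) (y : X) :
    ∃ δ : Σ z : X, z ⟶ y, ∀ β : Σ z : X, z ⟶ y, β ≠ δ → f ⟨β.1, y, β.2⟩ = 0 := by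
  by_cases h : ∃ δ : Σ z : X, z ⟶ y, ⟨δ.1, y, δ.2⟩ ∈ U
  · obtain ⟨δ, hδ⟩ := h
    exact ⟨δ, hf.eq_zero_of_ne hU hδ⟩
  · push Not at h
    exact ⟨⟨y, 𝟙 y⟩, fun β _ => hf.2 _ (h β)⟩

end GroupoidSheafOfRings

/-- The first projection of the pullback of an open map is open. -/
lemma isOpenMap_fst_of_pullback {P A B C : Type*} [TopologicalSpace P] [TopologicalSpace A]
    [TopologicalSpace B] [TopologicalSpace C] {i : P → A × B} (hi : IsInducing i)
    {f : A → C} {g : B → C} (hf : Continuous f) (hg : IsOpenMap g)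
    (hr : ∀ a b, f a = g b → (a, b) ∈ Set.range i) (hr' : ∀ p, f (i p).1 = g (i p).2) :
    IsOpenMap fun p => (i p).1 := by
  intro W hW
  obtain ⟨V, hV, rfl⟩ := hi.isOpen_iff.1 hW
  rw [isOpen_iff_mem_nhds]
  rintro _ ⟨p, hp, rfl⟩
  obtain ⟨A₀, B₀, hA₀, hB₀, hpA, hpB, hAB⟩ := isOpen_prod_iff.1 hV (i p).1 (i p).2 hp
  refine Filter.mem_of_superset ((hA₀.inter ((hg _ hB₀).preimage hf)).mem_nhds
    ⟨hpA, ⟨_, hpB, (hr' p).symm⟩⟩) ?_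
  rintro a ⟨ha, b, hb, hab⟩
  obtain ⟨q, hq⟩ := hr a b hab.symm
  exact ⟨q, by rw [Set.mem_preimage, hq]; exact hAB ⟨ha, hb⟩, by simp [hq]⟩


namespace AmpleGroupoid

variable {X : Type u} [Groupoid.{v} X] [TopologicalSpace (Quiver.Total X)]

lemma continuous_outer : Continuous fun q : ComposablePair X =>
    (⟨q.y, q.z, q.outer⟩ : Quiver.Total X) :=
  continuous_fst.comp (continuous_induced_dom (f := ComposablePair.toProd))

lemma continuous_inner : Continuous fun q : ComposablePair X =>
    (⟨q.x, q.y, q.inner⟩ : Quiver.Total X) :=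
  continuous_snd.comp (continuous_induced_dom (f := ComposablePair.toProd))

variable [TopologicalSpace X] [AmpleGroupoid X]

lemma continuous_toProd_comp {Y : Type*} [TopologicalSpace Y] {F : Y → ComposablePair X}
    (h : Continuous fun t => ((F t).mul, (⟨(F t).y, (F t).z, (F t).outer⟩ : Quiver.Total X))) :
    Continuous fun t => (F t).toProd := by
  have h1 := continuous_fst.comp h
  have h2 := continuous_snd.comp h
  have h4 : Continuous fun t =>
      (⟨Groupoid.inv (F t).outer, (F t).inner ≫ (F t).outer⟩ : ComposablePair X) :=
    continuous_induced_rng.2 ((continuous_inv.comp h2).prodMk h1)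
  refine h2.prodMk ?_
  convert continuous_mul.comp h4 using 2 with t
  simp [ComposablePair.mul]

lemma isInducing_shear : IsInducing fun q : ComposablePair X =>
    (q.mul, (⟨q.y, q.z, q.outer⟩ : Quiver.Total X)) := by
  constructor
  apply le_antisymm
  · exact continuous_iff_le_induced.1 (continuous_mul.prodMk continuous_outer)
  · exact continuous_iff_le_induced.1
      (@continuous_toProd_comp X _ _ _ _ (ComposablePair X) (TopologicalSpace.induced
        (fun q : ComposablePair X => (q.mul, (⟨q.y, q.z, q.outer⟩ : Quiver.Total X))) inferInstance)
        id continuous_induced_dom)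

lemma isOpenMap_mul : IsOpenMap (ComposablePair.mul : ComposablePair X → Quiver.Total X) := by
  refine isOpenMap_fst_of_pullback isInducing_shear
    (f := fun γ => γ.right) (g := fun γ => γ.right) continuous_range
    isLocalHomeomorph_range.isOpenMap ?_ ?_
  · rintro ⟨x, z, a⟩ ⟨y, z', b⟩ h
    obtain rfl : z = z' := h
    exact ⟨⟨b, a ≫ Groupoid.inv b⟩, by simp [ComposablePair.mul]⟩
  · intro q; rfl

/-- The product of two compact open bisections. -/
lemma isCompactOpenBisection_mul {U V : Set (Quiver.Total X)} (hU : IsCompactOpenBisection U)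
    (hV : IsCompactOpenBisection V) :
    IsCompactOpenBisection (ComposablePair.mul '' (ComposablePair.toProd ⁻¹' (U ×ˢ V))) := by
  have ho : IsOpen (ComposablePair.toProd ⁻¹' (U ×ˢ V) : Set (ComposablePair X)) :=
    (hU.isOpen.prod hV.isOpen).preimage continuous_induced_dom
  have := t2 (X := X)
  refine ⟨isOpenMap_mul _ ho, ?_, ?_, ?_⟩
  · refine IsCompact.image ?_ continuous_mul
    refine IsInducing.isCompact_preimage (f := ComposablePair.toProd) ⟨rfl⟩ ?_
      (hU.isCompact.prod hV.isCompact)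
    have : Set.range (ComposablePair.toProd : ComposablePair X → _) =
        {p | p.1.left = p.2.right} := by
      ext ⟨⟨x, y, a⟩, ⟨x', y', b⟩⟩
      constructor
      · rintro ⟨q, hq⟩
        simp only [ComposablePair.toProd, Prod.mk.injEq, Quiver.Total.mk.injEq] at hq
        exact hq.1.1.symm.trans hq.2.2.1
      · intro h
        obtain rfl : x = y' := h
        exact ⟨⟨a, b⟩, rfl⟩
    rw [this]
    exact isClosed_eq (continuous_source.comp continuous_fst) (continuous_range.comp continuous_snd)
  · rintro _ ⟨⟨β, ρ⟩, hq, rfl⟩ _ ⟨⟨β', ρ'⟩, hq', rfl⟩ h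
    have h1 := hV.source_injOn hq.2 hq'.2 h
    simp only [ComposablePair.toProd, Quiver.Total.mk.injEq] at h1
    obtain ⟨rfl, rfl, h1⟩ := h1
    obtain rfl := eq_of_heq h1
    have h2 := hU.source_injOn hq.1 hq'.1 rfl
    simp only [ComposablePair.toProd, Quiver.Total.mk.injEq] at h2
    obtain ⟨-, rfl, h2⟩ := h2
    rw [eq_of_heq h2]
  · rintro _ ⟨⟨β, ρ⟩, hq, rfl⟩ _ ⟨⟨β', ρ'⟩, hq', rfl⟩ h
    have h1 := hU.range_injOn hq.1 hq'.1 h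
    simp only [ComposablePair.toProd, Quiver.Total.mk.injEq] at h1
    obtain ⟨rfl, rfl, h1⟩ := h1
    obtain rfl := eq_of_heq h1
    have h2 := hV.range_injOn hq.2 hq'.2 rfl
    simp only [ComposablePair.toProd, Quiver.Total.mk.injEq] at h2
    obtain ⟨rfl, -, h2⟩ := h2
    rw [eq_of_heq h2]

/-- The unit space is open in the arrow space. -/
lemma isOpen_unitArrows : IsOpen (unitArrows X) := by
  rw [isOpen_iff_mem_nhds]
  rintro _ ⟨x, rfl⟩
  obtain ⟨W, hW, hxW, hinj⟩ :=
    (isLocalHomeomorph_range (X := X)).isLocallyInjective ⟨x, x, 𝟙 x⟩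
  have hW' := hW.preimage ((continuous_unit (X := X)).comp continuous_range)
  refine Filter.mem_of_superset ((hW.inter hW').mem_nhds ⟨hxW, hxW⟩) ?_
  rintro γ ⟨h1, h2⟩
  exact ⟨γ.right, hinj h2 h1 rfl⟩

end AmpleGroupoid

namespace GroupoidSheafOfRings

variable {X : Type u} [Groupoid.{v} X] [TopologicalSpace (Quiver.Total X)]

lemma isInducing_fiberPair {Y : Type u} {S : Y → Type w} [TopologicalSpace (Σ x, S x)] :
    IsInducing (FiberPair.toProd : FiberPair S → _) := ⟨rfl⟩

lemma isInducing_actionPair {S : X → Type w} [TopologicalSpace (Σ x, S x)] :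
    IsInducing (ActionPair.toProd : ActionPair S → _) := ⟨rfl⟩

variable [TopologicalSpace X]

lemma SupportedOn.conv [AmpleGroupoid X] {O : GroupoidSheafOfRings.{w} X}
    {f g : ∀ γ : Quiver.Total X, O.stalk γ.right} {U V : Set (Quiver.Total X)}
    (hU : IsCompactOpenBisection U) (hV : IsCompactOpenBisection V)
    (hf : O.SupportedOn f U) (hg : O.SupportedOn g V) :
    O.SupportedOn (O.conv f g) (ComposablePair.mul '' (ComposablePair.toProd ⁻¹' (U ×ˢ V))) := by
  have ho : IsOpen (ComposablePair.toProd ⁻¹' (U ×ˢ V) : Set (ComposablePair X)) :=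
    (hU.isOpen.prod hV.isOpen).preimage continuous_induced_dom
  constructor
  · rintro _ ⟨q, hq, rfl⟩
    apply ContinuousAt.continuousWithinAt
    rw [ContinuousAt, ← AmpleGroupoid.isOpenMap_mul.map_nhds_eq
      AmpleGroupoid.continuous_mul.continuousAt, Filter.tendsto_map'_iff]
    have key : ∀ q ∈ (ComposablePair.toProd ⁻¹' (U ×ˢ V) : Set (ComposablePair X)),
        O.conv f g q.mul =
          f ⟨q.y, q.z, q.outer⟩ * O.act q.outer (g ⟨q.x, q.y, q.inner⟩) := by
      rintro ⟨β, ρ⟩ hq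
      refine (O.conv_apply_of_unique f g β (hf.eq_zero_of_ne hU hq.1) (ρ ≫ β)).trans ?_
      have e : (ρ ≫ β) ≫ Groupoid.inv β = ρ := by simp
      rw [e]
    have h : ContinuousAt (fun q : ComposablePair X => (⟨q.z,
        f ⟨q.y, q.z, q.outer⟩ * O.act q.outer (g ⟨q.x, q.y, q.inner⟩)⟩ : Σ x, O.stalk x)) q := by
      have h1 : ContinuousAt (fun q : ComposablePair X =>
          (⟨q.z, f ⟨q.y, q.z, q.outer⟩⟩ : Σ x, O.stalk x)) q :=
        ContinuousAt.comp (g := fun γ : Quiver.Total X => (⟨γ.right, f γ⟩ : Σ x, O.stalk x))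
          (f := fun q : ComposablePair X => (⟨q.y, q.z, q.outer⟩ : Quiver.Total X))
          (hf.1.continuousAt (hU.isOpen.mem_nhds hq.1))
          AmpleGroupoid.continuous_outer.continuousAt
      have h2 : ContinuousAt (fun q : ComposablePair X =>
          (⟨q.y, g ⟨q.x, q.y, q.inner⟩⟩ : Σ x, O.stalk x)) q :=
        ContinuousAt.comp (g := fun γ : Quiver.Total X => (⟨γ.right, g γ⟩ : Σ x, O.stalk x))
          (f := fun q : ComposablePair X => (⟨q.x, q.y, q.inner⟩ : Quiver.Total X))
          (hg.1.continuousAt (hV.isOpen.mem_nhds hq.2))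
          AmpleGroupoid.continuous_inner.continuousAt
      have h3 : ContinuousAt (fun q : ComposablePair X =>
          (⟨⟨q.y, q.z, q.outer⟩, g ⟨q.x, q.y, q.inner⟩⟩ : ActionPair O.stalk)) q :=
        isInducing_actionPair.continuousAt_iff.2
          (AmpleGroupoid.continuous_outer.continuousAt.prodMk h2)
      have h4 := ContinuousAt.comp O.continuous_act.continuousAt h3
      have h5 : ContinuousAt (fun q : ComposablePair X => (⟨q.z, f ⟨q.y, q.z, q.outer⟩,
          O.act q.outer (g ⟨q.x, q.y, q.inner⟩)⟩ : FiberPair O.stalk)) q :=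
        isInducing_fiberPair.continuousAt_iff.2 (h1.prodMk h4)
      exact ContinuousAt.comp O.continuous_mul.continuousAt h5
    have h' := h.tendsto
    simp only [← key q hq] at h'
    refine h'.congr' ?_
    filter_upwards [ho.mem_nhds hq] with p hp
    simp only [← key p hp]
    rfl
  · rintro ⟨x, y, γ⟩ hγ
    obtain ⟨⟨z, δ⟩, hδ⟩ := hf.exists_unique hU y
    rw [O.conv_apply_of_unique f g δ hδ γ]
    by_cases h1 : (⟨z, y, δ⟩ : Quiver.Total X) ∈ U
    · by_cases h2 : (⟨x, z, γ ≫ Groupoid.inv δ⟩ : Quiver.Total X) ∈ V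
      · exact absurd ⟨⟨δ, γ ≫ Groupoid.inv δ⟩, ⟨h1, h2⟩, by simp [ComposablePair.mul]⟩ hγ
      · rw [hg.2 _ h2]; simp
    · rw [hf.2 _ h1]; simp

lemma conv_mem [AmpleGroupoid X] (O : GroupoidSheafOfRings.{w} X)
    {f g : ∀ γ : Quiver.Total X, O.stalk γ.right} (hf : f ∈ O.convAlgebra)
    (hg : g ∈ O.convAlgebra) : O.conv f g ∈ O.convAlgebra := by
  refine AddSubgroup.closure_induction₂ (p := fun f g _ _ => O.conv f g ∈ O.convAlgebra)
    ?_ ?_ ?_ ?_ ?_ ?_ ?_ hf hg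
  · rintro f g ⟨U, hU, -, hf⟩ ⟨V, hV, -, hg⟩
    exact AddSubgroup.subset_closure ⟨_, AmpleGroupoid.isCompactOpenBisection_mul hU hV,
      Set.subset_univ _, hf.conv hU hV hg⟩
  · intro g _; rw [zero_conv]; exact zero_mem _
  · intro f _; rw [conv_zero]; exact zero_mem _
  · intro f g h hf hg _ h1 h2; rw [O.add_conv hf hg]; exact add_mem h1 h2
  · intro g h f _ _ hf h1 h2; rw [O.conv_add hf]; exact add_mem h1 h2
  · intro f g _ _ h; rw [neg_conv]; exact neg_mem h
  · intro f g _ _ h; rw [conv_neg]; exact neg_mem h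

lemma conv_assoc [AmpleGroupoid X] (O : GroupoidSheafOfRings.{w} X)
    {f g : ∀ γ : Quiver.Total X, O.stalk γ.right} (hf : f ∈ O.convAlgebra)
    (hg : g ∈ O.convAlgebra) (h : ∀ γ : Quiver.Total X, O.stalk γ.right) :
    O.conv (O.conv f g) h = O.conv f (O.conv g h) := by
  induction hf using AddSubgroup.closure_induction with
  | mem f hf =>
    obtain ⟨U, hU, -, hf⟩ := hf
    funext ⟨x, y, γ⟩
    obtain ⟨⟨z, δ⟩, hδ⟩ := hf.exists_unique hU y
    rw [O.conv_apply_of_unique f _ δ hδ γ]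
    let e : (Σ t : X, t ⟶ z) ≃ (Σ t : X, t ⟶ y) :=
      { toFun := fun ε => ⟨ε.1, ε.2 ≫ δ⟩
        invFun := fun β => ⟨β.1, β.2 ≫ Groupoid.inv δ⟩
        left_inv := fun ε => by simp
        right_inv := fun β => by simp }
    have h1 : O.conv (O.conv f g) h ⟨x, y, γ⟩ = ∑ᶠ ε : Σ t : X, t ⟶ z,
        f ⟨z, y, δ⟩ * O.act δ (g ⟨ε.1, z, ε.2⟩ *
          O.act ε.2 (h ⟨x, ε.1, (γ ≫ Groupoid.inv δ) ≫ Groupoid.inv ε.2⟩)) := by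
      refine (finsum_comp_equiv e).symm.trans (finsum_congr fun ε => ?_)
      have h2 := O.conv_apply_of_unique f g δ hδ (ε.2 ≫ δ)
      change O.conv f g ⟨ε.1, y, ε.2 ≫ δ⟩ * O.act (ε.2 ≫ δ)
        (h ⟨x, ε.1, γ ≫ Groupoid.inv (ε.2 ≫ δ)⟩) = _
      have e1 : (ε.2 ≫ δ) ≫ Groupoid.inv δ = ε.2 := by simp
      have e2 : γ ≫ Groupoid.inv (ε.2 ≫ δ) =
          (γ ≫ Groupoid.inv δ) ≫ Groupoid.inv ε.2 := by simp [Groupoid.inv_eq_inv]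
      rw [h2, O.act_comp, map_mul, mul_assoc, e1, e2]
    rw [h1]
    have hfin := O.hasFiniteSupport_conv hg z fun ε =>
      O.act ε.2 (h ⟨x, ε.1, (γ ≫ Groupoid.inv δ) ≫ Groupoid.inv ε.2⟩)
    exact (((AddMonoidHom.mulLeft (f ⟨z, y, δ⟩)).comp
      (O.act δ).toAddMonoidHom).map_finsum hfin).symm
  | zero => simp only [zero_conv]
  | add f f' hf hf' h1 h2 =>
    rw [O.add_conv hf hf', O.add_conv (O.conv_mem hf hg) (O.conv_mem hf' hg), h1, h2,
      O.add_conv hf hf']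
  | neg f hf h1 => simp only [neg_conv, h1]

/-- `Γ_c(G, O)` is a ring under pointwise addition and convolution. -/
noncomputable instance [AmpleGroupoid X] (O : GroupoidSheafOfRings.{w} X) :
    NonUnitalRing O.convAlgebra where
  mul f g := ⟨O.conv f g, O.conv_mem f.2 g.2⟩
  left_distrib f g h := Subtype.ext (O.conv_add f.2 g h)
  right_distrib f g h := Subtype.ext (O.add_conv f.2 g.2 h)
  zero_mul f := Subtype.ext (O.zero_conv f)
  mul_zero f := Subtype.ext (O.conv_zero f)
  mul_assoc f g h := Subtype.ext (O.conv_assoc f.2 g.2 h)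

/-! ### The diagonal subring and the action of the compact open bisections -/

lemma isOpen_zero (O : GroupoidSheafOfRings.{w} X) : IsOpen {e : Σ x, O.stalk x | e.2 = 0} := by
  have h : Continuous fun e : Σ x, O.stalk x => (⟨e.1, e.2, e.2⟩ : FiberPair O.stalk) :=
    isInducing_fiberPair.continuous_iff.2 (continuous_id.prodMk continuous_id)
  have := O.isLocalHomeomorph_proj.isLocallyInjective.isOpen_eqLocus
    (O.continuous_add.comp h) continuous_id rfl
  convert this using 1
  ext ⟨x, a⟩
  simp

lemma continuous_zero (O : GroupoidSheafOfRings.{w} X) :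
    Continuous fun x : X => (⟨x, 0⟩ : Σ x, O.stalk x) := by
  refine continuous_def.2 fun W hW => ?_
  convert O.isLocalHomeomorph_proj.isOpenMap _ (hW.inter O.isOpen_zero) using 1
  ext x
  constructor
  · intro h
    exact ⟨⟨x, 0⟩, ⟨h, rfl⟩, rfl⟩
  · rintro ⟨⟨x, a⟩, ⟨h, h'⟩, rfl⟩
    obtain rfl : a = 0 := h'
    exact h

lemma continuous_neg (O : GroupoidSheafOfRings.{w} X) :
    Continuous fun e : Σ x, O.stalk x => (⟨e.1, -e.2⟩ : Σ x, O.stalk x) := by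
  refine continuous_def.2 fun W hW => ?_
  have ho : IsOpenMap fun q : FiberPair O.stalk => q.toProd.1 :=
    isOpenMap_fst_of_pullback isInducing_fiberPair
      O.isLocalHomeomorph_proj.continuous O.isLocalHomeomorph_proj.isOpenMap
      (by
        rintro ⟨x, a⟩ ⟨y, b⟩ h
        obtain rfl : x = y := h
        exact ⟨⟨x, a, b⟩, rfl⟩)
      (fun _ => rfl)
  convert ho _ ((O.isOpen_zero.preimage O.continuous_add).inter
    (hW.preimage (continuous_snd.comp isInducing_fiberPair.continuous))) using 1
  ext ⟨x, a⟩
  constructor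
  · intro h
    exact ⟨⟨x, a, -a⟩, ⟨by simp, h⟩, rfl⟩
  · rintro ⟨⟨y, b, c⟩, ⟨h, h'⟩, heq⟩
    obtain ⟨rfl, heq⟩ := Sigma.mk.inj heq
    obtain rfl := eq_of_heq heq
    obtain rfl : c = -b := (neg_eq_of_add_eq_zero_right h).symm
    exact h'

lemma isClosed_support (O : GroupoidSheafOfRings.{w} X) {s : ∀ x, O.stalk x}
    (hs : Continuous fun x => (⟨x, s x⟩ : Σ x, O.stalk x)) : IsClosed {x | s x ≠ 0} :=
  (O.isOpen_zero.preimage hs).isClosed_compl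

/-- The ring `Γ_c(G⁰, O)` of continuous sections with compact support over the unit space, with
pointwise operations. (The support of a continuous section is closed.) -/
def diagonal (O : GroupoidSheafOfRings.{w} X) : NonUnitalSubring (∀ x, O.stalk x) where
  carrier := {s | Continuous (fun x => (⟨x, s x⟩ : Σ x, O.stalk x)) ∧ IsCompact {x | s x ≠ 0}}
  zero_mem' := ⟨O.continuous_zero, by simp⟩
  add_mem' {s t} hs ht := by
    have h : Continuous fun x => (⟨x, (s + t) x⟩ : Σ x, O.stalk x) :=
      O.continuous_add.comp (f := fun x => (⟨x, s x, t x⟩ : FiberPair O.stalk))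
        (isInducing_fiberPair.continuous_iff.2 (hs.1.prodMk ht.1))
    refine ⟨h, (hs.2.union ht.2).of_isClosed_subset (O.isClosed_support h) ?_⟩
    intro x hx
    by_contra hx'
    simp only [Set.mem_union, Set.mem_ofPred_eq, not_or, not_not] at hx'
    exact hx (by simp [hx'.1, hx'.2])
  mul_mem' {s t} hs ht := by
    have h : Continuous fun x => (⟨x, (s * t) x⟩ : Σ x, O.stalk x) :=
      O.continuous_mul.comp (f := fun x => (⟨x, s x, t x⟩ : FiberPair O.stalk))
        (isInducing_fiberPair.continuous_iff.2 (hs.1.prodMk ht.1))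
    refine ⟨h, hs.2.of_isClosed_subset (O.isClosed_support h) ?_⟩
    intro x hx hx'
    exact hx (by simp [hx'])
  neg_mem' {s} hs := by
    refine ⟨O.continuous_neg.comp hs.1, ?_⟩
    simpa using hs.2

/-- Extension by zero of a section over the unit space to the arrow space. -/
noncomputable def extendByZero (O : GroupoidSheafOfRings.{w} X) (s : ∀ x, O.stalk x)
    (γ : Quiver.Total X) : O.stalk γ.right :=
  open Classical in if γ ∈ unitArrows X then s γ.right else 0

lemma exists_isCompact_isOpen_superset [AmpleGroupoid X] {K : Set X} (hK : IsCompact K) :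
    ∃ U : Set X, IsOpen U ∧ IsCompact U ∧ K ⊆ U := by
  refine hK.induction_on (p := fun K => ∃ U : Set X, IsOpen U ∧ IsCompact U ∧ K ⊆ U)
    ?_ ?_ ?_ ?_
  · exact ⟨∅, isOpen_empty, isCompact_empty, subset_rfl⟩
  · rintro s t hst ⟨U, h1, h2, h3⟩
    exact ⟨U, h1, h2, hst.trans h3⟩
  · rintro s t ⟨U, h1, h2, h3⟩ ⟨V, h1', h2', h3'⟩
    exact ⟨U ∪ V, h1.union h1', h2.union h2', Set.union_subset_union h3 h3'⟩
  · intro x _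
    obtain ⟨U, ⟨h1, h2⟩, h3, -⟩ := (AmpleGroupoid.isTopologicalBasis (X := X)).mem_nhds_iff.1
      (Filter.univ_mem (f := 𝓝 x))
    exact ⟨U, mem_nhdsWithin_of_mem_nhds (h1.mem_nhds h3), U, h1, h2, subset_rfl⟩

lemma extendByZero_mem [AmpleGroupoid X] (O : GroupoidSheafOfRings.{w} X) {s : ∀ x, O.stalk x}
    (hs : s ∈ O.diagonal) : O.extendByZero s ∈ O.convAlgebra := by
  obtain ⟨V, hV, hVc, hsV⟩ := exists_isCompact_isOpen_superset hs.2
  refine AddSubgroup.subset_closure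
    ⟨(fun x : X => (⟨x, x, 𝟙 x⟩ : Quiver.Total X)) '' V, ⟨?_, ?_, ?_, ?_⟩, Set.subset_univ _, ?_, ?_⟩
  · convert (AmpleGroupoid.isOpen_unitArrows (X := X)).inter
      (hV.preimage AmpleGroupoid.continuous_range) using 1
    ext γ
    constructor
    · rintro ⟨x, hx, rfl⟩
      exact ⟨⟨x, rfl⟩, hx⟩
    · rintro ⟨⟨x, rfl⟩, hx⟩
      exact ⟨x, hx, rfl⟩
  · exact hVc.image AmpleGroupoid.continuous_unit
  · rintro _ ⟨x, -, rfl⟩ _ ⟨y, -, rfl⟩ h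
    obtain rfl : x = y := h
    rfl
  · rintro _ ⟨x, -, rfl⟩ _ ⟨y, -, rfl⟩ h
    obtain rfl : x = y := h
    rfl
  · refine ((hs.1.comp AmpleGroupoid.continuous_range).continuousOn).congr ?_
    rintro _ ⟨x, -, rfl⟩
    have : (⟨x, x, 𝟙 x⟩ : Quiver.Total X) ∈ unitArrows X := ⟨x, rfl⟩
    simp [extendByZero, this]
  · intro γ hγ
    unfold extendByZero
    split_ifs with h
    · obtain ⟨x, rfl⟩ := h
      by_contra hx
      exact hγ ⟨x, hsV hx, rfl⟩
    · rfl

lemma extendByZero_mul (O : GroupoidSheafOfRings.{w} X) (s t : ∀ x, O.stalk x) :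
    O.extendByZero (s * t) = O.conv (O.extendByZero s) (O.extendByZero t) := by
  funext ⟨x, y, γ⟩
  rw [O.conv_apply_of_unique _ _ (𝟙 y) ?_ γ]
  · have h1 : (⟨y, y, 𝟙 y⟩ : Quiver.Total X) ∈ unitArrows X := ⟨y, rfl⟩
    have h2 : γ ≫ Groupoid.inv (𝟙 y) = γ := by simp [Groupoid.inv_eq_inv]
    rw [h2, O.act_id]
    by_cases h : (⟨x, y, γ⟩ : Quiver.Total X) ∈ unitArrows X <;> simp [extendByZero, h, h1]
  · rintro ⟨z, β⟩ hβ
    refine if_neg ?_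
    rintro ⟨z', h⟩
    simp only [Quiver.Total.mk.injEq] at h
    obtain ⟨rfl, rfl, h⟩ := h
    exact hβ (by rw [eq_of_heq h])

/-- The embedding of `Γ_c(G⁰, O)` in `Γ_c(G, O)`, by extension by zero. -/
noncomputable def diagonalEmbedding [AmpleGroupoid X] (O : GroupoidSheafOfRings.{w} X) :
    O.diagonal →ₙ+* O.convAlgebra where
  toFun s := ⟨O.extendByZero s, O.extendByZero_mem s.2⟩
  map_mul' s t := Subtype.ext (O.extendByZero_mul s t)
  map_zero' := Subtype.ext (by funext γ; simp [extendByZero])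
  map_add' s t := Subtype.ext (by
    funext γ
    by_cases h : γ ∈ unitArrows X <;> simp [extendByZero, h])

/-- `Γ_c(G⁰, O)` is a maximal commutative subring of `Γ_c(G, O)`. -/
def IsDiagonalMaximalCommutative [AmpleGroupoid X] (O : GroupoidSheafOfRings.{w} X) : Prop :=
  Maximal (fun S : NonUnitalSubring O.convAlgebra => ∀ a ∈ S, ∀ b ∈ S, a * b = b * a)
    (NonUnitalRingHom.range O.diagonalEmbedding)

/-- For a bisection `U`, the section whose value at the range of `γ ∈ U` is the image under `γ` of
the value of `s` at the source of `γ`, and which vanishes outside of the range of `U`. -/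
noncomputable def transport (O : GroupoidSheafOfRings.{w} X) (U : Set (Quiver.Total X))
    (s : ∀ x, O.stalk x) (x : X) : O.stalk x :=
  open Classical in
  if h : ∃ γ ∈ U, γ.right = x then
    h.choose_spec.2 ▸ O.act h.choose.hom (s h.choose.left)
  else 0

lemma transport_apply (O : GroupoidSheafOfRings.{w} X) {U : Set (Quiver.Total X)}
    (hU : IsCompactOpenBisection U) (s : ∀ x, O.stalk x) {γ : Quiver.Total X} (hγ : γ ∈ U) :
    O.transport U s γ.right = O.act γ.hom (s γ.left) := by
  have h : ∃ γ' ∈ U, γ'.right = γ.right := ⟨γ, hγ, rfl⟩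
  have key : ∀ γ' (_ : γ' ∈ U) (e : γ'.right = γ.right),
      (e ▸ O.act γ'.hom (s γ'.left) : O.stalk γ.right) = O.act γ.hom (s γ.left) := by
    intro γ' h' e
    obtain rfl := hU.range_injOn h' hγ e
    rfl
  rw [transport, dif_pos h]
  exact key _ h.choose_spec.1 h.choose_spec.2

lemma transport_eq_zero (O : GroupoidSheafOfRings.{w} X) {U : Set (Quiver.Total X)}
    (s : ∀ x, O.stalk x) {x : X} (hx : ¬ ∃ γ ∈ U, γ.right = x) : O.transport U s x = 0 :=
  dif_neg hx

lemma transport_mem [AmpleGroupoid X] (O : GroupoidSheafOfRings.{w} X)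
    {U : Set (Quiver.Total X)} (hU : IsCompactOpenBisection U) {s : ∀ x, O.stalk x}
    (hs : s ∈ O.diagonal) : O.transport U s ∈ O.diagonal := by
  have := AmpleGroupoid.t2 (X := X)
  have hc : IsCompact ((fun γ : Quiver.Total X => γ.right) '' U) :=
    hU.isCompact.image AmpleGroupoid.continuous_range
  have h : Continuous fun x => (⟨x, O.transport U s x⟩ : Σ x, O.stalk x) := by
    rw [continuous_iff_continuousAt]
    intro x
    by_cases hx : x ∈ (fun γ : Quiver.Total X => γ.right) '' U
    · obtain ⟨γ, hγ, rfl⟩ := hx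
      rw [ContinuousAt, ← AmpleGroupoid.isLocalHomeomorph_range.map_nhds_eq γ,
        Filter.tendsto_map'_iff]
      have h1 : Continuous fun γ : Quiver.Total X => (⟨γ, s γ.left⟩ : ActionPair O.stalk) :=
        isInducing_actionPair.continuous_iff.2
          (continuous_id.prodMk (hs.1.comp AmpleGroupoid.continuous_source))
      have h2 := ((O.continuous_act.comp h1).continuousAt (x := γ)).tendsto
      simp only [Function.comp_apply, ← O.transport_apply hU s hγ] at h2
      refine h2.congr' ?_
      filter_upwards [hU.isOpen.mem_nhds hγ] with γ' hγ'
      simp only [Function.comp_apply, O.transport_apply hU s hγ']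
    · refine O.continuous_zero.continuousAt.congr ?_
      filter_upwards [hc.isClosed.isOpen_compl.mem_nhds hx] with y hy
      rw [O.transport_eq_zero s hy]
  refine ⟨h, hc.of_isClosed_subset (O.isClosed_support h) ?_⟩
  intro x hx
  by_contra hx'
  exact hx (O.transport_eq_zero s hx')

/-- An ideal `I` of `Γ_c(G⁰, O)` is invariant if, for every compact open bisection `U`, the
isomorphism `D_{U⁻¹} → D_U` defined by `U` maps `I ∩ D_{U⁻¹}` into `I`; here `D_{U⁻¹}` and `D_U` are
the ideals of the sections vanishing outside of the source and the range of `U`. -/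
def IsInvariantIdeal [AmpleGroupoid X] (O : GroupoidSheafOfRings.{w} X)
    (I : TwoSidedIdeal O.diagonal) : Prop :=
  ∀ (U : Set (Quiver.Total X)) (hU : IsCompactOpenBisection U), ∀ s ∈ I,
    (∀ x, s.1 x ≠ 0 → ∃ γ ∈ U, γ.left = x) →
      (⟨O.transport U s.1, O.transport_mem hU s.2⟩ : O.diagonal) ∈ I

/-- `Γ_c(G⁰, O)` is simple for the action of the inverse semigroup of compact open bisections. -/
def IsDiagonalSimple [AmpleGroupoid X] (O : GroupoidSheafOfRings.{w} X) : Prop :=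
  ∀ I : TwoSidedIdeal O.diagonal, O.IsInvariantIdeal I → I = ⊥ ∨ I = ⊤

end GroupoidSheafOfRings

/-! Everything reduces to two properties: minimality, and property (B): every `f` in the convolution
algebra supported in `O.ker` is supported on the units. An element `f` commutes with a diagonal
section `s` iff `s(r γ) f(γ) = f(γ) α_γ(s(d γ))` for all `γ`. Stalks are fields and germs extend to
sections with small support, so the centralizer of the diagonal is `{f | supp f ⊆ ker}`
(`supp_subset_ker_iff`). Hence (B) is maximal commutativity of the diagonal; it is also equivalent
to the two conditions on the kernel in 3 (`interior_ker_eq_and_sectionsIn_eq_iff`).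

Minimality makes the diagonal simple: the points where some member of an invariant ideal is nonzero
form an open invariant set, open because nonzero germs are invertible. If that set is everything,
compactness puts enough indicators in the ideal.

From diagonal simplicity and (B) to simplicity: a nonzero element of an ideal is shortened by taking
commutators with diagonal sections until it lands in the diagonal (`exists_diagonalEmbedding_mem`).
The trace of the ideal on the diagonal is invariant, because transport along a bisection is
conjugation by its indicator (`conv_transport`). The trace is therefore the whole diagonal, which
contains local units for the algebra.

From simplicity back: an open invariant set `V` yields the ideal of elements vanishing over its
complement, which gives minimality. For (B), the algebra acts on families of stalk elements. If
`supp f ⊆ ker`, then `f` acts as multiplication by the section `f · 1`, as does the diagonal element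
`f · 1`; the representation is nonzero, so simplicity makes it faithful and `f` is diagonal.

For Hausdorff arrow spaces, elements of the algebra are continuous, so supports are open and
`Int(ker) = G⁰` alone implies (B). -/

namespace GroupoidSheafOfRings

section

variable {X : Type u} [Groupoid.{v} X] [TopologicalSpace X] [TopologicalSpace (Quiver.Total X)]

/-! ### Sections over the unit space -/

lemma continuous_of_isClopen (O : GroupoidSheafOfRings.{w} X) {s : ∀ x, O.stalk x} {W : Set X}
    (hW : IsClopen W) (hs : ∀ x ∈ W, ContinuousAt (fun x => (⟨x, s x⟩ : Σ x, O.stalk x)) x)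
    (h0 : ∀ x ∉ W, s x = 0) : Continuous fun x => (⟨x, s x⟩ : Σ x, O.stalk x) := by
  rw [continuous_iff_continuousAt]
  intro x
  by_cases hx : x ∈ W
  · exact hs x hx
  · refine O.continuous_zero.continuousAt.congr ?_
    filter_upwards [hW.1.isOpen_compl.mem_nhds hx] with y hy
    rw [h0 y hy]

lemma mem_diagonal_of_isCompact_isOpen [AmpleGroupoid X] (O : GroupoidSheafOfRings.{w} X)
    {s : ∀ x, O.stalk x} {W : Set X} (hWo : IsOpen W) (hWc : IsCompact W)
    (hs : ∀ x ∈ W, ContinuousAt (fun x => (⟨x, s x⟩ : Σ x, O.stalk x)) x)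
    (h0 : ∀ x ∉ W, s x = 0) : s ∈ O.diagonal := by
  have := AmpleGroupoid.t2 (X := X)
  have h := O.continuous_of_isClopen ⟨hWc.isClosed, hWo⟩ hs h0
  refine ⟨h, hWc.of_isClosed_subset (O.isClosed_support h) fun x hx => ?_⟩
  by_contra hx'
  exact hx (h0 x hx')

lemma exists_isCompact_isOpen_subset [AmpleGroupoid X] {V : Set X} (hV : IsOpen V) {x : X}
    (hx : x ∈ V) : ∃ W : Set X, IsOpen W ∧ IsCompact W ∧ x ∈ W ∧ W ⊆ V := by
  obtain ⟨W, ⟨h1, h2⟩, h3, h4⟩ := (AmpleGroupoid.isTopologicalBasis (X := X)).mem_nhds_iff.1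
    (hV.mem_nhds hx)
  exact ⟨W, h1, h2, h3, h4⟩

/-- Every germ extends to a compactly supported section with arbitrarily small support. -/
lemma exists_mem_diagonal_apply_eq [AmpleGroupoid X] (O : GroupoidSheafOfRings.{w} X) {V : Set X}
    (hV : IsOpen V) {x : X} (hx : x ∈ V) (a : O.stalk x) :
    ∃ s ∈ O.diagonal, s x = a ∧ ∀ y ∉ V, s y = 0 := by
  classical
  -- The section is the inverse of the projection on a neighbourhood `N` of the germ where it is
  -- injective, cut off by zero outside a compact open `W` inside `V` and the image of `N`.
  obtain ⟨N, hN, hxN, hinj⟩ := O.isLocalHomeomorph_proj.isLocallyInjective ⟨x, a⟩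
  obtain ⟨W, hWo, hWc, hxW, hW⟩ := exists_isCompact_isOpen_subset
    (hV.inter (O.isLocalHomeomorph_proj.isOpenMap _ hN)) ⟨hx, ⟨x, a⟩, hxN, rfl⟩
  have hex : ∀ y ∈ W, ∃ b : O.stalk y, (⟨y, b⟩ : Σ x, O.stalk x) ∈ N := by
    intro y hy
    obtain ⟨⟨y', b⟩, hb, rfl⟩ := (hW hy).2
    exact ⟨b, hb⟩
  have huniq : ∀ y (b b' : O.stalk y), (⟨y, b⟩ : Σ x, O.stalk x) ∈ N →
      (⟨y, b'⟩ : Σ x, O.stalk x) ∈ N → b = b' := by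
    intro y b b' h h'
    exact eq_of_heq (Sigma.mk.inj (hinj h h' rfl)).2
  let s : ∀ y, O.stalk y := fun y => if h : y ∈ W then (hex y h).choose else 0
  have hsN : ∀ y ∈ W, (⟨y, s y⟩ : Σ x, O.stalk x) ∈ N := by
    intro y hy
    simp only [s, dif_pos hy]
    exact (hex y hy).choose_spec
  refine ⟨s, O.mem_diagonal_of_isCompact_isOpen hWo hWc ?_ fun y hy => dif_neg hy,
    huniq x _ _ (hsN x hxW) hxN, fun y hy => dif_neg fun h => hy (hW h).1⟩
  intro y hy
  rw [continuousAt_def]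
  intro A hA
  obtain ⟨B, hBA, hB, hyB⟩ := mem_nhds_iff.1 hA
  -- Uniqueness in `N` forces the section to take its value in `B` over the image of `B ∩ N`, which
  -- is open.
  refine Filter.mem_of_superset ((hWo.inter (O.isLocalHomeomorph_proj.isOpenMap _
    (hB.inter hN))).mem_nhds ⟨hy, ⟨y, s y⟩, ⟨hyB, hsN y hy⟩, rfl⟩) ?_
  rintro z ⟨hz, ⟨z', b⟩, ⟨hb, hb'⟩, rfl⟩
  apply hBA
  change (⟨z', s z'⟩ : Σ x, O.stalk x) ∈ B
  rwa [huniq z' _ _ (hsN z' hz) hb']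

open Classical in
/-- The indicator section of a set of units. -/
noncomputable def indicatorSection (O : GroupoidSheafOfRings.{w} X) (W : Set X) (x : X) :
    O.stalk x := if x ∈ W then 1 else 0

lemma indicatorSection_of_mem (O : GroupoidSheafOfRings.{w} X) {W : Set X} {x : X} (h : x ∈ W) :
    O.indicatorSection W x = 1 := if_pos h

lemma indicatorSection_of_notMem (O : GroupoidSheafOfRings.{w} X) {W : Set X} {x : X}
    (h : x ∉ W) : O.indicatorSection W x = 0 := if_neg h

lemma indicatorSection_mem [AmpleGroupoid X] (O : GroupoidSheafOfRings.{w} X) {W : Set X}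
    (hWo : IsOpen W) (hWc : IsCompact W) : O.indicatorSection W ∈ O.diagonal := by
  refine O.mem_diagonal_of_isCompact_isOpen hWo hWc ?_ fun x hx => if_neg hx
  intro x hx
  refine O.continuous_one.continuousAt.congr ?_
  filter_upwards [hWo.mem_nhds hx] with y hy
  rw [O.indicatorSection_of_mem hy]

/-! ### Openness of the set of nonzero germs. -/

namespace IsSheafOfFields

variable {O : GroupoidSheafOfRings.{w} X}

lemma one_ne_zero (hO : O.IsSheafOfFields) (x : X) : (1 : O.stalk x) ≠ 0 := by
  have := (hO x).nontrivial
  exact _root_.one_ne_zero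

/-- The inverse of a nonzero germ extends to a section `t`. Two continuous lifts to the total space
agree on an open set, so multiplication by `t` still gives `1` nearby, which excludes zero there.
Over general rings only the zero set is open. -/
lemma isOpen_ne_zero [AmpleGroupoid X] (hO : O.IsSheafOfFields) :
    IsOpen {e : Σ x, O.stalk x | e.2 ≠ 0} := by
  rw [isOpen_iff_mem_nhds]
  rintro ⟨x, a⟩ (ha : a ≠ 0)
  obtain ⟨b, hb⟩ := (hO x).mul_inv_cancel ha
  obtain ⟨t, ht, rfl, -⟩ := O.exists_mem_diagonal_apply_eq isOpen_univ (Set.mem_univ x) b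
  have hp : Continuous (Sigma.fst : (Σ x, O.stalk x) → X) := O.isLocalHomeomorph_proj.continuous
  have h1 : Continuous fun e : Σ x, O.stalk x => (⟨e.1, e.2 * t e.1⟩ : Σ x, O.stalk x) :=
    O.continuous_mul.comp (f := fun e : Σ x, O.stalk x => (⟨e.1, e.2, t e.1⟩ : FiberPair O.stalk))
      (isInducing_fiberPair.continuous_iff.2 (continuous_id.prodMk (ht.1.comp hp)))
  have ho := O.isLocalHomeomorph_proj.isLocallyInjective.isOpen_eqLocus h1
    (O.continuous_one.comp hp) rfl
  refine Filter.mem_of_superset (ho.mem_nhds (Sigma.ext rfl (heq_of_eq hb))) ?_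
  rintro ⟨y, c⟩ hc (h0 : c = 0)
  have hc' : c * t y = 1 := eq_of_heq (Sigma.mk.inj hc).2
  rw [h0, zero_mul] at hc'
  exact hO.one_ne_zero y hc'.symm

lemma isOpen_support [AmpleGroupoid X] (hO : O.IsSheafOfFields) {s : ∀ x, O.stalk x}
    (hs : Continuous fun x => (⟨x, s x⟩ : Σ x, O.stalk x)) : IsOpen {x | s x ≠ 0} :=
  hO.isOpen_ne_zero.preimage hs

end IsSheafOfFields

end

end GroupoidSheafOfRings

/-! ### Compact open bisections: inverses and the basis property. -/

section

variable {X : Type u} [Groupoid.{v} X]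

lemma unit_mem_unitArrows (x : X) : (⟨x, x, 𝟙 x⟩ : Quiver.Total X) ∈ unitArrows X := ⟨x, rfl⟩

/-- The set of inverses of the arrows in a set. -/
def invArrows (U : Set (Quiver.Total X)) : Set (Quiver.Total X) :=
  {γ | (⟨γ.right, γ.left, Groupoid.inv γ.hom⟩ : Quiver.Total X) ∈ U}

variable [TopologicalSpace X] [TopologicalSpace (Quiver.Total X)] [AmpleGroupoid X]

lemma IsCompactOpenBisection.invArrows {U : Set (Quiver.Total X)}
    (hU : IsCompactOpenBisection U) : IsCompactOpenBisection (invArrows U) := by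
  refine ⟨hU.isOpen.preimage AmpleGroupoid.continuous_inv, ?_, ?_, ?_⟩
  · convert hU.isCompact.image AmpleGroupoid.continuous_inv using 1
    ext ⟨x, y, g⟩
    constructor
    · intro h
      exact ⟨_, h, by simp⟩
    · rintro ⟨⟨x', y', g'⟩, h, he⟩
      simp only [Quiver.Total.mk.injEq] at he
      obtain ⟨rfl, rfl, he⟩ := he
      obtain rfl := eq_of_heq he
      simpa [_root_.invArrows] using h
  · rintro ⟨x, y, g⟩ h ⟨x', y', g'⟩ h' he
    have := hU.range_injOn h h' he
    simp only [Quiver.Total.mk.injEq] at this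
    obtain ⟨rfl, rfl, this⟩ := this
    have := congrArg Groupoid.inv (eq_of_heq this)
    simp only [Groupoid.inv_eq_inv, IsIso.inv_inv] at this
    rw [this]
  · rintro ⟨x, y, g⟩ h ⟨x', y', g'⟩ h' he
    have := hU.source_injOn h h' he
    simp only [Quiver.Total.mk.injEq] at this
    obtain ⟨rfl, rfl, this⟩ := this
    have := congrArg Groupoid.inv (eq_of_heq this)
    simp only [Groupoid.inv_eq_inv, IsIso.inv_inv] at this
    rw [this]

/-- The compact open bisections form a basis of the topology of the arrow space. -/
lemma exists_isCompactOpenBisection {V : Set (Quiver.Total X)} (hV : IsOpen V)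
    {γ : Quiver.Total X} (hγ : γ ∈ V) : ∃ U, IsCompactOpenBisection U ∧ γ ∈ U ∧ U ⊆ V := by
  have hr := AmpleGroupoid.isLocalHomeomorph_range (X := X)
  obtain ⟨W, hW, hγW, hinj⟩ := hr.isLocallyInjective γ
  -- Injectivity of the range near `γ⁻¹` is injectivity of the source near `γ`.
  obtain ⟨W', hW', hγW', hinj'⟩ := hr.isLocallyInjective ⟨γ.right, γ.left, Groupoid.inv γ.hom⟩
  have hWs : IsOpen (invArrows W') := hW'.preimage AmpleGroupoid.continuous_inv
  obtain ⟨e, heγ, he⟩ := hr γ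
  have hN : IsOpen (V ∩ W ∩ invArrows W' ∩ e.source) :=
    ((hV.inter hW).inter hWs).inter e.open_source
  -- Compactness comes from the unit space: a compact open set of units around the range of `γ` is
  -- lifted through the local inverse of the range map.
  obtain ⟨K, hK, hKc, hγK, hKs⟩ := GroupoidSheafOfRings.exists_isCompact_isOpen_subset
    (hr.isOpenMap _ hN) (x := γ.right) ⟨γ, ⟨⟨⟨hγ, hγW⟩, hγW'⟩, heγ⟩, rfl⟩
  have hKt : K ⊆ e.target := by
    intro x hx
    obtain ⟨δ, hδ, rfl⟩ := hKs hx
    have := e.map_source hδ.2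
    rwa [← he] at this
  have hsub : e.symm '' K ⊆ V ∩ W ∩ invArrows W' ∩ e.source := by
    rintro _ ⟨x, hx, rfl⟩
    obtain ⟨δ, hδ, rfl⟩ := hKs hx
    have : e.symm δ.right = δ := by
      have := e.left_inv hδ.2
      rwa [← he] at this
    rwa [this]
  refine ⟨e.symm '' K, ⟨e.symm.isOpen_image_of_subset_source hK hKt,
    hKc.image_of_continuousOn (e.symm.continuousOn.mono hKt), ?_, ?_⟩, ?_, fun δ hδ =>
      (hsub hδ).1.1.1⟩
  · intro δ hδ δ' hδ' h
    have := hinj' (hsub hδ).1.2 (hsub hδ').1.2 h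
    obtain ⟨x, y, g⟩ := δ
    obtain ⟨x', y', g'⟩ := δ'
    simp only [Quiver.Total.mk.injEq] at this
    obtain ⟨rfl, rfl, this⟩ := this
    have := congrArg Groupoid.inv (eq_of_heq this)
    simp only [Groupoid.inv_eq_inv, IsIso.inv_inv] at this
    rw [this]
  · intro δ hδ δ' hδ' h
    exact hinj (hsub hδ).1.1.2 (hsub hδ').1.1.2 h
  · refine ⟨γ.right, hγK, ?_⟩
    have := e.left_inv heγ
    rwa [← he] at this

end

namespace GroupoidSheafOfRings

/-! ### Indicators of bisections and supports. -/

section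

variable {X : Type u} [Groupoid.{v} X] [TopologicalSpace X] [TopologicalSpace (Quiver.Total X)]

open Classical in
/-- The indicator of a set of arrows. -/
noncomputable def indicatorArrows (O : GroupoidSheafOfRings.{w} X) (U : Set (Quiver.Total X))
    (γ : Quiver.Total X) : O.stalk γ.right := if γ ∈ U then 1 else 0

lemma indicatorArrows_of_mem (O : GroupoidSheafOfRings.{w} X) {U : Set (Quiver.Total X)}
    {γ : Quiver.Total X} (h : γ ∈ U) : O.indicatorArrows U γ = 1 := if_pos h

lemma indicatorArrows_of_notMem (O : GroupoidSheafOfRings.{w} X) {U : Set (Quiver.Total X)}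
    {γ : Quiver.Total X} (h : γ ∉ U) : O.indicatorArrows U γ = 0 := if_neg h

lemma supportedOn_indicatorArrows [AmpleGroupoid X] (O : GroupoidSheafOfRings.{w} X)
    (U : Set (Quiver.Total X)) : O.SupportedOn (O.indicatorArrows U) U := by
  refine ⟨((O.continuous_one.comp AmpleGroupoid.continuous_range).continuousOn).congr ?_,
    fun γ h => O.indicatorArrows_of_notMem h⟩
  intro γ hγ
  simp only [O.indicatorArrows_of_mem hγ]
  rfl

lemma SupportedOn.mem_convAlgebra {O : GroupoidSheafOfRings.{w} X}
    {f : ∀ γ : Quiver.Total X, O.stalk γ.right} {U : Set (Quiver.Total X)}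
    (hf : O.SupportedOn f U) (hU : IsCompactOpenBisection U) : f ∈ O.convAlgebra :=
  AddSubgroup.subset_closure ⟨U, hU, Set.subset_univ _, hf⟩

lemma indicatorArrows_mem [AmpleGroupoid X] (O : GroupoidSheafOfRings.{w} X)
    {U : Set (Quiver.Total X)} (hU : IsCompactOpenBisection U) :
    O.indicatorArrows U ∈ O.convAlgebra :=
  (O.supportedOn_indicatorArrows U).mem_convAlgebra hU

lemma sectionsIn_le_convAlgebra (O : GroupoidSheafOfRings.{w} X) (H : Set (Quiver.Total X)) :
    O.sectionsIn H ≤ O.convAlgebra :=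
  AddSubgroup.closure_mono fun _ ⟨U, hU, _, hf⟩ => ⟨U, hU, Set.subset_univ _, hf⟩

lemma supp_subset_of_mem_sectionsIn (O : GroupoidSheafOfRings.{w} X) {H : Set (Quiver.Total X)}
    {f : ∀ γ : Quiver.Total X, O.stalk γ.right} (hf : f ∈ O.sectionsIn H) : O.supp f ⊆ H := by
  intro γ hγ
  by_contra hH
  refine hγ ?_
  induction hf using AddSubgroup.closure_induction with
  | mem f hf =>
    obtain ⟨U, -, hUH, hf⟩ := hf
    exact hf.2 _ fun h => hH (hUH h)
  | zero => rfl
  | add f g _ _ hf hg =>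
    have hf : f γ = 0 := by by_contra h; exact h (hf h)
    have hg : g γ = 0 := by by_contra h; exact h (hg h)
    simp [hf, hg]
  | neg f _ hf =>
    have hf : f γ = 0 := by by_contra h; exact h (hf h)
    simp [hf]

/-! ### Extension by zero and convolution -/

lemma extendByZero_unit (O : GroupoidSheafOfRings.{w} X) (s : ∀ x, O.stalk x) (x : X) :
    O.extendByZero s ⟨x, x, 𝟙 x⟩ = s x := if_pos (unit_mem_unitArrows x)

lemma extendByZero_of_notMem (O : GroupoidSheafOfRings.{w} X) (s : ∀ x, O.stalk x)
    {γ : Quiver.Total X} (h : γ ∉ unitArrows X) : O.extendByZero s γ = 0 := if_neg h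

lemma extendByZero_conv (O : GroupoidSheafOfRings.{w} X) (s : ∀ x, O.stalk x)
    (f : ∀ γ : Quiver.Total X, O.stalk γ.right) (γ : Quiver.Total X) :
    O.conv (O.extendByZero s) f γ = s γ.right * f γ := by
  obtain ⟨x, y, g⟩ := γ
  rw [O.conv_apply_of_unique _ _ (𝟙 y) ?_ g]
  · have h2 : g ≫ Groupoid.inv (𝟙 y) = g := by simp [Groupoid.inv_eq_inv]
    rw [h2, O.act_id, extendByZero_unit]
  · rintro ⟨z, β⟩ hβ
    refine O.extendByZero_of_notMem s ?_
    rintro ⟨z', h⟩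
    simp only [Quiver.Total.mk.injEq] at h
    obtain ⟨rfl, rfl, h⟩ := h
    exact hβ (by rw [eq_of_heq h])

/-- If `g` vanishes at `β⁻¹γ` unless `β = δ`, then the convolution sum reduces to one term. -/
lemma conv_apply_of_unique_right (O : GroupoidSheafOfRings.{w} X)
    (f g : ∀ γ : Quiver.Total X, O.stalk γ.right) {x y z : X} (γ : x ⟶ y) (δ : z ⟶ y)
    (hδ : ∀ β : Σ z : X, z ⟶ y, β ≠ ⟨z, δ⟩ → f ⟨β.1, y, β.2⟩ ≠ 0 →
      g ⟨x, β.1, γ ≫ Groupoid.inv β.2⟩ = 0) :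
    O.conv f g ⟨x, y, γ⟩ = f ⟨z, y, δ⟩ * O.act δ (g ⟨x, z, γ ≫ Groupoid.inv δ⟩) := by
  refine finsum_eq_single _ (⟨z, δ⟩ : Σ z : X, z ⟶ y) ?_
  intro β hβ
  by_cases h : f ⟨β.1, y, β.2⟩ = 0
  · simp [h]
  · simp [hδ β hβ h]

/-- Multiplying by a section on the right evaluates it at the source and transports it along `γ`,
while `extendByZero_conv` evaluates it at the range. Comparing the two formulas detects the kernel.
-/
lemma conv_extendByZero (O : GroupoidSheafOfRings.{w} X) (s : ∀ x, O.stalk x)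
    (f : ∀ γ : Quiver.Total X, O.stalk γ.right) (γ : Quiver.Total X) :
    O.conv f (O.extendByZero s) γ = f γ * O.act γ.hom (s γ.left) := by
  obtain ⟨x, y, g⟩ := γ
  rw [O.conv_apply_of_unique_right _ _ g g]
  · have h2 : g ≫ Groupoid.inv g = 𝟙 x := by simp
    rw [h2, extendByZero_unit]
  · rintro ⟨z, β⟩ hβ -
    refine O.extendByZero_of_notMem s ?_
    rintro ⟨z', h⟩
    simp only [Quiver.Total.mk.injEq] at h
    obtain ⟨rfl, rfl, h⟩ := h
    have h := congrArg (· ≫ β) (eq_of_heq h)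
    simp only [Category.id_comp, Category.assoc, Groupoid.inv_comp, Category.comp_id] at h
    exact hβ (by rw [h])

/-- Convolving with the indicator of the inverse of a bisection `U` moves the value at `γ ∈ U` to
the range of `γ`. -/
lemma conv_indicatorArrows_invArrows (O : GroupoidSheafOfRings.{w} X)
    (f : ∀ γ : Quiver.Total X, O.stalk γ.right) {U : Set (Quiver.Total X)}
    (hU : Set.InjOn (fun γ : Quiver.Total X => γ.right) U) {x y : X} {g : x ⟶ y}
    (hg : (⟨x, y, g⟩ : Quiver.Total X) ∈ U) :
    O.conv f (O.indicatorArrows (invArrows U)) ⟨y, y, 𝟙 y⟩ = f ⟨x, y, g⟩ := by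
  rw [O.conv_apply_of_unique_right _ _ (𝟙 y) g]
  · rw [O.indicatorArrows_of_mem, map_one, mul_one]
    simpa [invArrows] using hg
  · rintro ⟨z, β⟩ hβ -
    refine O.indicatorArrows_of_notMem fun h => hβ ?_
    have h' : (⟨z, y, β⟩ : Quiver.Total X) ∈ U := by simpa [invArrows] using h
    have := hU h' hg rfl
    simp only [Quiver.Total.mk.injEq] at this
    obtain ⟨rfl, -, h⟩ := this
    rw [eq_of_heq h]

/-- The support of a convolution product. -/
lemma exists_of_conv_ne_zero (O : GroupoidSheafOfRings.{w} X)
    {f g : ∀ γ : Quiver.Total X, O.stalk γ.right} {γ : Quiver.Total X} (h : O.conv f g γ ≠ 0) :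
    ∃ q : ComposablePair X, q.mul = γ ∧ f ⟨q.y, q.z, q.outer⟩ ≠ 0 ∧ g ⟨q.x, q.y, q.inner⟩ ≠ 0 := by
  obtain ⟨β, hβ⟩ : ∃ β : Σ z : X, z ⟶ γ.right,
      f ⟨β.1, γ.right, β.2⟩ * O.act β.2 (g ⟨γ.left, β.1, γ.hom ≫ Groupoid.inv β.2⟩) ≠ 0 := by
    by_contra! h'
    exact h (finsum_eq_zero_of_forall_eq_zero h')
  refine ⟨⟨β.2, γ.hom ≫ Groupoid.inv β.2⟩, by simp [ComposablePair.mul], fun h0 => hβ ?_,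
    fun h0 => hβ ?_⟩
  · simp [h0]
  · simp [h0]

lemma supp_conv_subset (O : GroupoidSheafOfRings.{w} X)
    {f g : ∀ γ : Quiver.Total X, O.stalk γ.right} {U V : Set (Quiver.Total X)}
    (hf : O.supp f ⊆ U) (hg : O.supp g ⊆ V) :
    O.supp (O.conv f g) ⊆ ComposablePair.mul '' (ComposablePair.toProd ⁻¹' (U ×ˢ V)) := by
  intro γ hγ
  obtain ⟨q, hq, h1, h2⟩ := O.exists_of_conv_ne_zero hγ
  exact ⟨q, ⟨hf h1, hg h2⟩, hq⟩

/-- The product `U U⁻¹` of a bisection with its inverse consists of units. -/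
lemma supp_conv_indicatorArrows_invArrows_subset (O : GroupoidSheafOfRings.{w} X)
    {f : ∀ γ : Quiver.Total X, O.stalk γ.right} {U : Set (Quiver.Total X)}
    (hU : IsCompactOpenBisection U) (hf : O.supp f ⊆ U) :
    O.supp (O.conv f (O.indicatorArrows (invArrows U))) ⊆ unitArrows X := by
  intro γ hγ
  obtain ⟨⟨β, ρ⟩, rfl, h1, h2⟩ := O.exists_of_conv_ne_zero hγ
  have h1 := hf h1
  have h2 := not_imp_comm.1 O.indicatorArrows_of_notMem h2
  have := hU.source_injOn h1 h2 rfl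
  simp only [Quiver.Total.mk.injEq] at this
  obtain ⟨-, rfl, h⟩ := this
  obtain rfl := eq_of_heq h
  simp [ComposablePair.mul, unit_mem_unitArrows]

/-- Transport along `U` is conjugation by the indicator of `U`, since `U U⁻¹` consists of units.
Two-sided ideals therefore have invariant traces on the diagonal. -/
lemma conv_transport (O : GroupoidSheafOfRings.{w} X) {U : Set (Quiver.Total X)}
    (hU : IsCompactOpenBisection U) (s : ∀ x, O.stalk x) :
    O.conv (O.conv (O.indicatorArrows U) (O.extendByZero s)) (O.indicatorArrows (invArrows U)) =
      O.extendByZero (O.transport U s) := by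
  have hne : ∀ γ, O.conv (O.indicatorArrows U) (O.extendByZero s) γ ≠ 0 → γ ∈ U := by
    intro γ h
    by_contra hγ
    exact h (by rw [conv_extendByZero, O.indicatorArrows_of_notMem hγ, zero_mul])
  funext γ
  by_cases hu : γ ∈ unitArrows X
  · obtain ⟨y, rfl⟩ := hu
    rw [extendByZero_unit]
    by_cases h : ∃ γ ∈ U, γ.right = y
    · obtain ⟨⟨x, y, g⟩, hg, rfl⟩ := h
      rw [O.conv_indicatorArrows_invArrows _ hU.range_injOn hg, conv_extendByZero,
        O.indicatorArrows_of_mem hg, one_mul, O.transport_apply hU s hg]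
    · rw [O.transport_eq_zero s h]
      by_contra h0
      obtain ⟨q, hq, h1, -⟩ := O.exists_of_conv_ne_zero h0
      exact h ⟨_, hne _ h1, congrArg Quiver.Total.right hq⟩
  · rw [O.extendByZero_of_notMem _ hu]
    by_contra h0
    obtain ⟨⟨β, ρ⟩, rfl, h1, h2⟩ := O.exists_of_conv_ne_zero h0
    have h1 := hne _ h1
    have h2 := not_imp_comm.1 O.indicatorArrows_of_notMem h2
    have := hU.source_injOn h1 h2 rfl
    simp only [Quiver.Total.mk.injEq] at this
    obtain ⟨-, rfl, h⟩ := this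
    obtain rfl := eq_of_heq h
    exact hu (by simp [ComposablePair.mul, unit_mem_unitArrows])

end

section

variable {X : Type u} [Groupoid.{v} X] [TopologicalSpace X] [TopologicalSpace (Quiver.Total X)]

/-! ### The representation of the convolution algebra on sections -/

/-- The action of a map on arrows on a section over the unit space,
`(f · s)(x) = ∑_{r(γ) = x} f(γ) α_γ(s(d(γ)))`. -/
noncomputable def actSection (O : GroupoidSheafOfRings.{w} X)
    (f : ∀ γ : Quiver.Total X, O.stalk γ.right) (s : ∀ x, O.stalk x) (x : X) : O.stalk x :=
  ∑ᶠ β : Σ z : X, z ⟶ x, f ⟨β.1, x, β.2⟩ * O.act β.2 (s β.1)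

/-- A family `s` is viewed as the map `s ∘ r` on arrows. This map need not lie in the algebra, but
the last factor in `conv_assoc` is arbitrary, so the laws of a representation are inherited from
convolution. -/
lemma actSection_eq_conv (O : GroupoidSheafOfRings.{w} X)
    (f : ∀ γ : Quiver.Total X, O.stalk γ.right) (s : ∀ x, O.stalk x) :
    O.actSection f s = fun x => O.conv f (fun γ => s γ.right) ⟨x, x, 𝟙 x⟩ := rfl

lemma actSection_conv [AmpleGroupoid X] (O : GroupoidSheafOfRings.{w} X)
    {f g : ∀ γ : Quiver.Total X, O.stalk γ.right} (hf : f ∈ O.convAlgebra)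
    (hg : g ∈ O.convAlgebra) (s : ∀ x, O.stalk x) :
    O.actSection (O.conv f g) s = O.actSection f (O.actSection g s) := by
  rw [actSection_eq_conv, O.conv_assoc hf hg]
  rfl

lemma actSection_add (O : GroupoidSheafOfRings.{w} X)
    {f g : ∀ γ : Quiver.Total X, O.stalk γ.right} (hf : f ∈ O.convAlgebra)
    (hg : g ∈ O.convAlgebra) (s : ∀ x, O.stalk x) :
    O.actSection (f + g) s = O.actSection f s + O.actSection g s := by
  rw [actSection_eq_conv, O.add_conv hf hg]
  rfl

lemma actSection_neg (O : GroupoidSheafOfRings.{w} X)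
    (f : ∀ γ : Quiver.Total X, O.stalk γ.right) (s : ∀ x, O.stalk x) :
    O.actSection (-f) s = -O.actSection f s := by
  rw [actSection_eq_conv, neg_conv]
  rfl

lemma zero_actSection (O : GroupoidSheafOfRings.{w} X) (s : ∀ x, O.stalk x) :
    O.actSection 0 s = 0 := by
  rw [actSection_eq_conv, zero_conv]
  rfl

lemma actSection_zero (O : GroupoidSheafOfRings.{w} X)
    (f : ∀ γ : Quiver.Total X, O.stalk γ.right) : O.actSection f 0 = 0 := by
  funext x
  simp [actSection]

lemma actSection_extendByZero (O : GroupoidSheafOfRings.{w} X) (s t : ∀ x, O.stalk x) :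
    O.actSection (O.extendByZero s) t = s * t := by
  rw [actSection_eq_conv]
  funext x
  rw [extendByZero_conv]
  rfl

lemma SupportedOn.actSection_one_mem [AmpleGroupoid X] {O : GroupoidSheafOfRings.{w} X}
    {f : ∀ γ : Quiver.Total X, O.stalk γ.right} {U : Set (Quiver.Total X)}
    (hU : IsCompactOpenBisection U) (hf : O.SupportedOn f U) : O.actSection f 1 ∈ O.diagonal := by
  have key : ∀ γ ∈ U, O.actSection f 1 γ.right = f γ := by
    rintro ⟨x, y, g⟩ hg
    refine (finsum_eq_single _ (⟨x, g⟩ : Σ z : X, z ⟶ y) fun β hβ => ?_).trans (by simp)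
    rw [hf.eq_zero_of_ne hU hg β hβ, zero_mul]
  refine O.mem_diagonal_of_isCompact_isOpen
    (AmpleGroupoid.isLocalHomeomorph_range.isOpenMap _ hU.isOpen)
    (hU.isCompact.image AmpleGroupoid.continuous_range) ?_ ?_
  · rintro _ ⟨γ, hγ, rfl⟩
    rw [ContinuousAt, ← AmpleGroupoid.isLocalHomeomorph_range.map_nhds_eq γ,
      Filter.tendsto_map'_iff]
    have h := (hf.1.continuousAt (hU.isOpen.mem_nhds hγ)).tendsto
    simp only [← key γ hγ] at h
    refine h.congr' ?_
    filter_upwards [hU.isOpen.mem_nhds hγ] with γ' hγ'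
    simp only [Function.comp_apply, key γ' hγ']
  · intro x hx
    refine finsum_eq_zero_of_forall_eq_zero fun β => ?_
    rw [hf.2 _ fun h => hx ⟨_, h, rfl⟩, zero_mul]

/-- The section `f · 1` sums `f` over the fibres of the range map. On a bisection each sum has at
most one term, so continuity survives even where `f` itself, extended by zero, is discontinuous on a
non-Hausdorff arrow space. -/
lemma actSection_one_mem [AmpleGroupoid X] (O : GroupoidSheafOfRings.{w} X)
    {f : ∀ γ : Quiver.Total X, O.stalk γ.right} (hf : f ∈ O.convAlgebra) :
    O.actSection f 1 ∈ O.diagonal := by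
  induction hf using AddSubgroup.closure_induction with
  | mem f hf =>
    obtain ⟨U, hU, -, hf⟩ := hf
    exact hf.actSection_one_mem hU
  | zero => rw [zero_actSection]; exact zero_mem _
  | add f g hf hg h1 h2 => rw [O.actSection_add hf hg]; exact add_mem h1 h2
  | neg f _ h => rw [actSection_neg]; exact neg_mem h

/-- Each fibre sum has only the term at the unit. With `actSection_one_mem`, an element of the
algebra supported on the units belongs to the diagonal. -/
lemma eq_extendByZero_of_supp_subset (O : GroupoidSheafOfRings.{w} X)
    {f : ∀ γ : Quiver.Total X, O.stalk γ.right} (hf : O.supp f ⊆ unitArrows X) :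
    f = O.extendByZero (O.actSection f 1) := by
  funext γ
  by_cases hγ : γ ∈ unitArrows X
  · obtain ⟨x, rfl⟩ := hγ
    rw [extendByZero_unit]
    refine ((finsum_eq_single _ (⟨x, 𝟙 x⟩ : Σ z : X, z ⟶ x) fun β hβ => ?_).trans (by simp)).symm
    have : f ⟨β.1, x, β.2⟩ = 0 := by
      by_contra h
      obtain ⟨y, hy⟩ := hf h
      obtain ⟨z, β⟩ := β
      simp only [Quiver.Total.mk.injEq] at hy
      obtain ⟨rfl, rfl, h⟩ := hy
      exact hβ (by rw [eq_of_heq h])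
    rw [this, zero_mul]
  · rw [O.extendByZero_of_notMem _ hγ]
    by_contra h
    exact hγ (hf h)

lemma supp_extendByZero_subset (O : GroupoidSheafOfRings.{w} X) (s : ∀ x, O.stalk x) :
    O.supp (O.extendByZero s) ⊆ unitArrows X := fun _ h =>
  not_imp_comm.1 (O.extendByZero_of_notMem s) h

lemma unitArrows_subset_ker (O : GroupoidSheafOfRings.{w} X) : unitArrows X ⊆ O.ker := by
  rintro _ ⟨x, rfl⟩
  exact ⟨x, 𝟙 x, rfl, O.act_id x⟩

lemma unitArrows_subset_interior_ker [AmpleGroupoid X] (O : GroupoidSheafOfRings.{w} X) :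
    unitArrows X ⊆ interior O.ker :=
  interior_maximal O.unitArrows_subset_ker AmpleGroupoid.isOpen_unitArrows

/-- Refines `extendByZero_mem` by recording that the bisection can be taken inside the units. -/
lemma extendByZero_mem_sectionsIn [AmpleGroupoid X] (O : GroupoidSheafOfRings.{w} X)
    {s : ∀ x, O.stalk x} (hs : s ∈ O.diagonal) :
    O.extendByZero s ∈ O.sectionsIn (unitArrows X) := by
  obtain ⟨V, hV, hVc, hsV⟩ := exists_isCompact_isOpen_superset hs.2
  refine AddSubgroup.subset_closure
    ⟨(fun x : X => (⟨x, x, 𝟙 x⟩ : Quiver.Total X)) '' V, ⟨?_, ?_, ?_, ?_⟩, ?_, ?_, ?_⟩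
  · convert (AmpleGroupoid.isOpen_unitArrows (X := X)).inter
      (hV.preimage AmpleGroupoid.continuous_range) using 1
    ext γ
    constructor
    · rintro ⟨x, hx, rfl⟩
      exact ⟨⟨x, rfl⟩, hx⟩
    · rintro ⟨⟨x, rfl⟩, hx⟩
      exact ⟨x, hx, rfl⟩
  · exact hVc.image AmpleGroupoid.continuous_unit
  · rintro _ ⟨x, -, rfl⟩ _ ⟨y, -, rfl⟩ h
    obtain rfl : x = y := h
    rfl
  · rintro _ ⟨x, -, rfl⟩ _ ⟨y, -, rfl⟩ h
    obtain rfl : x = y := h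
    rfl
  · rintro _ ⟨x, -, rfl⟩
    exact ⟨x, rfl⟩
  · refine ((hs.1.comp AmpleGroupoid.continuous_range).continuousOn).congr ?_
    rintro _ ⟨x, -, rfl⟩
    simp only [extendByZero_unit]
    rfl
  · intro γ hγ
    by_contra h
    obtain ⟨x, rfl⟩ := O.supp_extendByZero_subset s h
    rw [extendByZero_unit] at h
    exact hγ ⟨x, hsV h, rfl⟩

/-- Arrows of the kernel are isotropy arrows acting trivially, so the common factor `s x` leaves the
finite sum. -/
lemma actSection_of_supp_subset_ker (O : GroupoidSheafOfRings.{w} X)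
    {f : ∀ γ : Quiver.Total X, O.stalk γ.right} (hf : f ∈ O.convAlgebra) (hk : O.supp f ⊆ O.ker)
    (s : ∀ x, O.stalk x) : O.actSection f s = O.actSection f 1 * s := by
  funext x
  have h1 : O.actSection f s x = ∑ᶠ β : Σ z : X, z ⟶ x,
      f ⟨β.1, x, β.2⟩ * O.act β.2 ((1 : ∀ x, O.stalk x) β.1) * s x := by
    refine finsum_congr fun ⟨z, β⟩ => ?_
    by_cases h : f ⟨z, x, β⟩ = 0
    · simp [h]
    · obtain ⟨y, g, he, hg⟩ := hk h
      simp only [Quiver.Total.mk.injEq] at he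
      obtain ⟨rfl, rfl, he⟩ := he
      obtain rfl := eq_of_heq he
      simp [hg]
  rw [h1]
  exact (finsum_mul' _ _ (O.hasFiniteSupport_conv hf x _)).symm

/-! ### The centralizer of the diagonal -/

/-- Where `f` is nonzero it can be cancelled, leaving `s(r γ) = α_γ(s(d γ))` for every section `s`.
A section equal to `1` at the range and `0` at the source rules out distinct endpoints; sections
through arbitrary germs then show that `γ` acts trivially. -/
lemma supp_subset_ker_iff [AmpleGroupoid X] {O : GroupoidSheafOfRings.{w} X}
    (hO : O.IsSheafOfFields) (f : ∀ γ : Quiver.Total X, O.stalk γ.right) :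
    O.supp f ⊆ O.ker ↔ ∀ s ∈ O.diagonal,
      O.conv (O.extendByZero s) f = O.conv f (O.extendByZero s) := by
  constructor
  · intro h s _
    funext γ
    rw [extendByZero_conv, conv_extendByZero]
    by_cases h0 : f γ = 0
    · simp [h0]
    · obtain ⟨x, g, rfl, hg⟩ := h h0
      simp only [hg]
      exact (hO x).mul_comm _ _
  · rintro h ⟨x, y, g⟩ (hg : f _ ≠ 0)
    have key : ∀ s ∈ O.diagonal, s y = O.act g (s x) := by
      intro s hs
      have h1 := congrFun (h s hs) ⟨x, y, g⟩
      rw [extendByZero_conv, conv_extendByZero] at h1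
      obtain ⟨b, hb⟩ := (hO y).mul_inv_cancel hg
      calc s y = s y * (f ⟨x, y, g⟩ * b) := by rw [hb, mul_one]
        _ = f ⟨x, y, g⟩ * O.act g (s x) * b := by rw [← mul_assoc]; exact congrArg (· * b) h1
        _ = O.act g (s x) * (f ⟨x, y, g⟩ * b) := by
          rw [(hO y).mul_comm (f ⟨x, y, g⟩), mul_assoc]
        _ = O.act g (s x) := by rw [hb, mul_one]
    have hxy : y = x := by
      by_contra hne
      have := AmpleGroupoid.t2 (X := X)
      obtain ⟨s, hs, hs1, hs0⟩ := O.exists_mem_diagonal_apply_eq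
        (isOpen_compl_singleton (x := x)) (x := y) hne 1
      have h1 := key s hs
      rw [hs1, hs0 x (by simp), map_zero] at h1
      exact hO.one_ne_zero y h1
    subst hxy
    refine ⟨y, g, rfl, fun a => ?_⟩
    obtain ⟨s, hs, rfl, -⟩ := O.exists_mem_diagonal_apply_eq isOpen_univ (Set.mem_univ y) a
    exact (key s hs).symm

/-- The diagonal is maximal commutative if and only if every element of the convolution algebra
that is supported in the kernel is supported on the units. -/
lemma isDiagonalMaximalCommutative_iff [AmpleGroupoid X] {O : GroupoidSheafOfRings.{w} X}
    (hO : O.IsSheafOfFields) : O.IsDiagonalMaximalCommutative ↔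
      ∀ f ∈ O.convAlgebra, O.supp f ⊆ O.ker → O.supp f ⊆ unitArrows X := by
  have hcomm : ∀ a ∈ NonUnitalRingHom.range O.diagonalEmbedding,
      ∀ b ∈ NonUnitalRingHom.range O.diagonalEmbedding, a * b = b * a := by
    rintro _ ⟨s, rfl⟩ _ ⟨t, rfl⟩
    rw [← map_mul, ← map_mul]
    congr 1
    refine Subtype.ext (funext fun x => ?_)
    exact (hO x).mul_comm _ _
  constructor
  · intro h f hf hk
    have hc : ∀ s : O.diagonal, O.diagonalEmbedding s * ⟨f, hf⟩ = ⟨f, hf⟩ * O.diagonalEmbedding s :=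
      fun s => Subtype.ext ((supp_subset_ker_iff hO f).1 hk s.1 s.2)
    have hins : ∀ a ∈ insert ⟨f, hf⟩ (NonUnitalRingHom.range O.diagonalEmbedding : Set O.convAlgebra),
        ∀ b ∈ insert ⟨f, hf⟩ (NonUnitalRingHom.range O.diagonalEmbedding : Set O.convAlgebra),
          a * b = b * a := by
      rintro a (rfl | ha) b (rfl | hb)
      · rfl
      · obtain ⟨t, rfl⟩ := hb
        exact (hc t).symm
      · obtain ⟨t, rfl⟩ := ha
        exact hc t
      · exact hcomm a ha b hb
    -- The subring generated by the diagonal and `f` is commutative, so maximality puts `f` in the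
    -- diagonal.
    have hcl := NonUnitalSubring.isMulCommutative_closure hins
    have hle := h.2 (y := NonUnitalSubring.closure (insert ⟨f, hf⟩
        (NonUnitalRingHom.range O.diagonalEmbedding : Set O.convAlgebra)))
      (fun a ha b hb => setLike_mul_comm ha hb)
      (fun a ha => NonUnitalSubring.subset_closure (Set.mem_insert_of_mem _ ha))
    obtain ⟨s, hs⟩ := hle (NonUnitalSubring.subset_closure (Set.mem_insert _ _))
    have hs : O.extendByZero s.1 = f := congrArg Subtype.val hs
    rw [← hs]
    exact O.supp_extendByZero_subset _
  · refine fun h => ⟨hcomm, fun S hS hle a ha => ?_⟩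
    have hu := h a.1 a.2 ((supp_subset_ker_iff hO a.1).2 fun s hs =>
      congrArg Subtype.val (hS _ (hle ⟨⟨s, hs⟩, rfl⟩) a ha))
    exact ⟨⟨_, O.actSection_one_mem a.2⟩, Subtype.ext (O.eq_extendByZero_of_supp_subset hu).symm⟩

lemma indicatorArrows_ne_zero {O : GroupoidSheafOfRings.{w} X} (hO : O.IsSheafOfFields)
    {U : Set (Quiver.Total X)} {γ : Quiver.Total X} (h : γ ∈ U) : O.indicatorArrows U γ ≠ 0 := by
  rw [O.indicatorArrows_of_mem h]
  exact hO.one_ne_zero _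

/-- A compact open bisection inside the interior of the kernel has an indicator supported in the
kernel and nonzero on all of it, so the right-hand side forces it to consist of units. -/
lemma interior_ker_eq_and_sectionsIn_eq_iff [AmpleGroupoid X] {O : GroupoidSheafOfRings.{w} X}
    (hO : O.IsSheafOfFields) : (interior O.ker = unitArrows X ∧
      (O.sectionsIn (interior O.ker) : Set (∀ γ : Quiver.Total X, O.stalk γ.right)) =
        {f | f ∈ O.convAlgebra ∧ O.supp f ⊆ O.ker}) ↔
      ∀ f ∈ O.convAlgebra, O.supp f ⊆ O.ker → O.supp f ⊆ unitArrows X := by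
  constructor
  · rintro ⟨h1, h2⟩ f hf hk
    rw [h1] at h2
    have : f ∈ (O.sectionsIn (unitArrows X) : Set (∀ γ : Quiver.Total X, O.stalk γ.right)) := by
      rw [h2]
      exact ⟨hf, hk⟩
    exact O.supp_subset_of_mem_sectionsIn this
  · intro h
    have h1 : interior O.ker = unitArrows X := by
      refine Set.Subset.antisymm (fun γ hγ => ?_) O.unitArrows_subset_interior_ker
      obtain ⟨U, hU, hγU, hUk⟩ := exists_isCompactOpenBisection isOpen_interior hγ
      refine h _ (O.indicatorArrows_mem hU) (fun δ hδ => ?_) (indicatorArrows_ne_zero hO hγU)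
      exact interior_subset (hUk (not_imp_comm.1 O.indicatorArrows_of_notMem hδ))
    refine ⟨h1, ?_⟩
    rw [h1]
    ext f
    constructor
    · intro hf
      exact ⟨O.sectionsIn_le_convAlgebra _ hf,
        (O.supp_subset_of_mem_sectionsIn hf).trans O.unitArrows_subset_ker⟩
    · rintro ⟨hf, hk⟩
      rw [O.eq_extendByZero_of_supp_subset (h f hf hk)]
      exact O.extendByZero_mem_sectionsIn (O.actSection_one_mem hf)

end

section

variable {X : Type u} [Groupoid.{v} X] [TopologicalSpace X] [TopologicalSpace (Quiver.Total X)]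

/-! ### Invariant ideals of the diagonal and minimality -/

lemma act_ne_zero (O : GroupoidSheafOfRings.{w} X) {x y : X} (g : x ⟶ y) {a : O.stalk x}
    (ha : a ≠ 0) : O.act g a ≠ 0 := by
  intro h
  have h1 := O.act_comp g (Groupoid.inv g) a
  rw [h, map_zero, Groupoid.comp_inv, O.act_id] at h1
  exact ha h1

variable [AmpleGroupoid X]

lemma exists_mem_diagonal_ne_zero {O : GroupoidSheafOfRings.{w} X} (hO : O.IsSheafOfFields)
    {V : Set X} (hV : IsOpen V) {x : X} (hx : x ∈ V) :
    ∃ s : O.diagonal, s.1 x ≠ 0 ∧ ∀ y ∉ V, s.1 y = 0 := by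
  obtain ⟨s, hs, hs1, hs0⟩ := O.exists_mem_diagonal_apply_eq hV hx 1
  exact ⟨⟨s, hs⟩, fun h => hO.one_ne_zero x (hs1.symm.trans h), hs0⟩

/-- An ideal of the diagonal without common zeros contains the indicators of arbitrarily large
compact open sets. -/
lemma exists_indicatorSection_mem {O : GroupoidSheafOfRings.{w} X} (hO : O.IsSheafOfFields)
    {I : TwoSidedIdeal O.diagonal} (hI : ∀ x, ∃ s ∈ I, s.1 x ≠ 0) {K : Set X} (hK : IsCompact K) :
    ∃ W, ∃ hW : IsOpen W, ∃ hWc : IsCompact W, K ⊆ W ∧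
      (⟨_, O.indicatorSection_mem hW hWc⟩ : O.diagonal) ∈ I := by
  refine hK.induction_on (p := fun K => ∃ W, ∃ hW : IsOpen W, ∃ hWc : IsCompact W, K ⊆ W ∧
      (⟨_, O.indicatorSection_mem hW hWc⟩ : O.diagonal) ∈ I) ?_ ?_ ?_ ?_
  · refine ⟨∅, isOpen_empty, isCompact_empty, subset_rfl, ?_⟩
    refine (congrArg (· ∈ I) (Subtype.ext ?_)).mpr I.zero_mem
    exact (funext fun x => O.indicatorSection_of_notMem (Set.notMem_empty x))
  · rintro s t hst ⟨W, h1, h2, h3, h4⟩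
    exact ⟨W, h1, h2, hst.trans h3, h4⟩
  · rintro s t ⟨W, h1, h2, h3, h4⟩ ⟨W', h1', h2', h3', h4'⟩
    refine ⟨W ∪ W', h1.union h1', h2.union h2', Set.union_subset_union h3 h3', ?_⟩
    -- Inclusion-exclusion: the indicator of a union is the sum of the two indicators minus their
    -- product.
    refine (congrArg (· ∈ I) (Subtype.ext (funext fun x => ?_))).mpr (I.sub_mem (I.add_mem h4 h4')
      (I.mul_mem_left ⟨_, O.indicatorSection_mem h1 h2⟩ _ h4'))
    change O.indicatorSection (W ∪ W') x = O.indicatorSection W x + O.indicatorSection W' x -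
      O.indicatorSection W x * O.indicatorSection W' x
    by_cases hx : x ∈ W <;> by_cases hx' : x ∈ W' <;> simp [indicatorSection, hx, hx']
  · intro x _
    obtain ⟨s, hs, hsx⟩ := hI x
    obtain ⟨b, hb⟩ := (hO x).mul_inv_cancel hsx
    -- A section through the inverse germ makes `s t = 1` near `x`; cutting down to `W` gives an
    -- indicator in the ideal.
    obtain ⟨t, ht, rfl, -⟩ := O.exists_mem_diagonal_apply_eq isOpen_univ (Set.mem_univ x) b
    have ho : IsOpen {y | (s.1 * t) y = 1} := by
      convert O.isLocalHomeomorph_proj.isLocallyInjective.isOpen_eqLocus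
        (mul_mem s.2 ht).1 O.continuous_one rfl using 1
      ext y
      simp
    obtain ⟨W, hW, hWc, hxW, hWs⟩ := exists_isCompact_isOpen_subset ho hb
    refine ⟨W, mem_nhdsWithin_of_mem_nhds (hW.mem_nhds hxW), W, hW, hWc, subset_rfl, ?_⟩
    refine (congrArg (· ∈ I) (Subtype.ext (funext fun y => ?_))).mpr
      (I.mul_mem_right _ ⟨_, O.indicatorSection_mem hW hWc⟩ (I.mul_mem_right s ⟨t, ht⟩ hs))
    change O.indicatorSection W y = s.1 y * t y * O.indicatorSection W y
    by_cases hy : y ∈ W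
    · have : s.1 y * t y = 1 := hWs hy
      rw [this, one_mul]
    · rw [O.indicatorSection_of_notMem hy, mul_zero]

lemma isDiagonalSimple_of_isMinimalGroupoid {O : GroupoidSheafOfRings.{w} X}
    (hO : O.IsSheafOfFields) (h : IsMinimalGroupoid X) : O.IsDiagonalSimple := by
  intro I hI
  have hV : IsOpen {x | ∃ s ∈ I, s.1 x ≠ 0} := by
    have : {x | ∃ s ∈ I, s.1 x ≠ 0} = ⋃ s ∈ I, {x | s.1 x ≠ 0} := by
      ext x
      simp
    rw [this]
    exact isOpen_biUnion fun s _ => hO.isOpen_support s.2.1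
  have hinv : ∀ γ : Quiver.Total X, γ.left ∈ {x | ∃ s ∈ I, s.1 x ≠ 0} →
      γ.right ∈ {x | ∃ s ∈ I, s.1 x ≠ 0} := by
    rintro γ ⟨s, hs, hsx⟩
    obtain ⟨U, hU, hγU, -⟩ := exists_isCompactOpenBisection isOpen_univ (Set.mem_univ γ)
    -- Invariance concerns only sections vanishing outside the source of `U`, so `s` is first cut
    -- down to a compact open set `W` there; the source of `U` appears as the range of `U⁻¹`.
    obtain ⟨W, hW, hWc, hxW, hWU⟩ := exists_isCompact_isOpen_subset
      (AmpleGroupoid.isLocalHomeomorph_range.isOpenMap _ hU.invArrows.isOpen) (x := γ.left)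
      ⟨⟨γ.right, γ.left, Groupoid.inv γ.hom⟩, by simpa [invArrows] using hγU, rfl⟩
    refine ⟨_, hI U hU _ (I.mul_mem_left ⟨_, O.indicatorSection_mem hW hWc⟩ s hs) ?_, ?_⟩
    · intro x hx
      have hxW : x ∈ W := by
        by_contra hxW
        refine hx ?_
        change O.indicatorSection W x * s.1 x = 0
        rw [O.indicatorSection_of_notMem hxW, zero_mul]
      obtain ⟨δ, hδ, rfl⟩ := hWU hxW
      exact ⟨_, hδ, rfl⟩
    · change O.transport U (O.indicatorSection W * s.1) γ.right ≠ 0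
      rw [O.transport_apply hU _ hγU]
      refine O.act_ne_zero _ ?_
      rwa [Pi.mul_apply, O.indicatorSection_of_mem hxW, one_mul]
  rcases h _ hV hinv with h | h
  · refine Or.inl (le_bot_iff.1 fun s hs => (TwoSidedIdeal.mem_bot _).2 ?_)
    refine Subtype.ext (funext fun x => ?_)
    by_contra hx
    have : x ∈ {x | ∃ s ∈ I, s.1 x ≠ 0} := ⟨s, hs, hx⟩
    rw [h] at this
    exact this
  · refine Or.inr (top_le_iff.1 fun s _ => ?_)
    obtain ⟨W, hW, hWc, hKW, hWI⟩ := exists_indicatorSection_mem hO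
      (fun x => (h.symm ▸ Set.mem_univ x : x ∈ {x | ∃ s ∈ I, s.1 x ≠ 0})) s.2.2
    refine (congrArg (· ∈ I) (Subtype.ext (funext fun x => ?_))).mpr (I.mul_mem_right _ s hWI)
    change s.1 x = O.indicatorSection W x * s.1 x
    by_cases hx : x ∈ W
    · rw [O.indicatorSection_of_mem hx, one_mul]
    · have : s.1 x = 0 := by
        by_contra h
        exact hx (hKW h)
      rw [this, mul_zero]

/-! ### Simplicity of the convolution algebra -/

/-- The ideal of the elements that vanish at the arrows with range outside of an invariant set. -/
noncomputable def rangeIdeal (O : GroupoidSheafOfRings.{w} X) {V : Set X}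
    (hV : ∀ γ : Quiver.Total X, γ.left ∈ V → γ.right ∈ V) : TwoSidedIdeal O.convAlgebra :=
  TwoSidedIdeal.mk' {f | ∀ γ, γ.right ∉ V → f.1 γ = 0}
    (fun _ _ => rfl)
    (fun {f g} hf hg γ hγ => by
      change f.1 γ + g.1 γ = 0
      rw [hf γ hγ, hg γ hγ, add_zero])
    (fun {f} hf γ hγ => by
      change -f.1 γ = 0
      rw [hf γ hγ, neg_zero])
    -- Only left multiplication uses invariance: the outer arrow carries the range of the inner one
    -- to the range of the product.
    (fun {f g} hg γ hγ => by
      change O.conv f.1 g.1 γ = 0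
      by_contra h
      obtain ⟨q, rfl, -, h2⟩ := O.exists_of_conv_ne_zero h
      exact h2 (hg _ fun h => hγ (hV ⟨_, _, q.outer⟩ h)))
    (fun {f g} hf γ hγ => by
      change O.conv f.1 g.1 γ = 0
      by_contra h
      obtain ⟨q, rfl, h1, -⟩ := O.exists_of_conv_ne_zero h
      exact h1 (hf _ hγ))

lemma mem_rangeIdeal {O : GroupoidSheafOfRings.{w} X} {V : Set X}
    {hV : ∀ γ : Quiver.Total X, γ.left ∈ V → γ.right ∈ V} {f : O.convAlgebra} :
    f ∈ O.rangeIdeal hV ↔ ∀ γ, γ.right ∉ V → f.1 γ = 0 := TwoSidedIdeal.mem_mk' _ _ _ _ _ _ _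

/-- The ideal of `V` contains every diagonal section supported in `V` and none that is nonzero at a
point outside `V`; it is thus zero only for empty `V` and everything only for full `V`. -/
lemma isMinimalGroupoid_of_isSimpleRing {O : GroupoidSheafOfRings.{w} X}
    (hO : O.IsSheafOfFields) (h : IsSimpleRing O.convAlgebra) : IsMinimalGroupoid X := by
  intro V hV hinv
  rcases h.simple.eq_bot_or_eq_top (O.rangeIdeal hinv) with h | h
  · refine Or.inl (Set.eq_empty_of_forall_notMem fun x hx => ?_)
    obtain ⟨s, hs, hs0⟩ := exists_mem_diagonal_ne_zero hO hV hx
    have : O.diagonalEmbedding s ∈ O.rangeIdeal hinv := mem_rangeIdeal.2 fun γ hγ => by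
      by_contra h0
      obtain ⟨y, rfl⟩ := O.supp_extendByZero_subset s.1 h0
      exact h0 ((O.extendByZero_unit s.1 y).trans (hs0 y hγ))
    rw [h, TwoSidedIdeal.mem_bot] at this
    refine hs ((O.extendByZero_unit s.1 x).symm.trans ?_)
    exact congrFun (congrArg Subtype.val this) _
  · refine Or.inr (Set.eq_univ_of_forall fun x => ?_)
    obtain ⟨s, hs, -⟩ := exists_mem_diagonal_ne_zero hO isOpen_univ (Set.mem_univ x)
    have : O.diagonalEmbedding s ∈ O.rangeIdeal hinv := by rw [h]; trivial
    by_contra hx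
    exact hs ((O.extendByZero_unit s.1 x).symm.trans (mem_rangeIdeal.1 this ⟨x, x, 𝟙 x⟩ hx))

/-- The kernel of the representation of the convolution algebra on sections. -/
noncomputable def actSectionKer (O : GroupoidSheafOfRings.{w} X) : TwoSidedIdeal O.convAlgebra :=
  -- All families of stalk elements are allowed here, continuous or not.
  TwoSidedIdeal.mk' {f | ∀ s, O.actSection f.1 s = 0}
    (fun s => O.zero_actSection s)
    (fun {f g} hf hg s => by
      change O.actSection (f.1 + g.1) s = 0
      rw [O.actSection_add f.2 g.2, hf s, hg s, add_zero])
    (fun {f} hf s => by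
      change O.actSection (-f.1) s = 0
      rw [actSection_neg, hf s, neg_zero])
    (fun {f g} hg s => by
      change O.actSection (O.conv f.1 g.1) s = 0
      rw [O.actSection_conv f.2 g.2, hg s, actSection_zero])
    (fun {f g} hf s => by
      change O.actSection (O.conv f.1 g.1) s = 0
      rw [O.actSection_conv f.2 g.2, hf])

lemma mem_actSectionKer {O : GroupoidSheafOfRings.{w} X} {f : O.convAlgebra} :
    f ∈ O.actSectionKer ↔ ∀ s, O.actSection f.1 s = 0 := TwoSidedIdeal.mem_mk' _ _ _ _ _ _ _

/-- Both `f` and the diagonal element `f · 1` act as multiplication by `f · 1`, so their difference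
lies in the kernel of the representation. That kernel is proper because a nonzero diagonal section
acts nontrivially on `1`. -/
lemma supp_subset_unitArrows_of_isSimpleRing [Nonempty X] {O : GroupoidSheafOfRings.{w} X}
    (hO : O.IsSheafOfFields) (h : IsSimpleRing O.convAlgebra) :
    ∀ f ∈ O.convAlgebra, O.supp f ⊆ O.ker → O.supp f ⊆ unitArrows X := by
  intro f hf hk
  have hbot : O.actSectionKer = ⊥ := by
    refine (h.simple.eq_bot_or_eq_top _).resolve_right fun htop => ?_
    obtain ⟨x⟩ := ‹Nonempty X›
    obtain ⟨s, hs, -⟩ := exists_mem_diagonal_ne_zero hO isOpen_univ (Set.mem_univ x)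
    have : O.diagonalEmbedding s ∈ O.actSectionKer := by rw [htop]; trivial
    have := (O.actSection_extendByZero s.1 1).symm.trans (mem_actSectionKer.1 this 1)
    rw [mul_one] at this
    exact hs (congrFun this x)
  have hmem : (⟨f, hf⟩ - O.diagonalEmbedding ⟨_, O.actSection_one_mem hf⟩ : O.convAlgebra) ∈
      O.actSectionKer := by
    refine mem_actSectionKer.2 fun s => ?_
    change O.actSection (f - O.extendByZero (O.actSection f 1)) s = 0
    have he := O.extendByZero_mem (O.actSection_one_mem hf)
    rw [sub_eq_add_neg, O.actSection_add hf (neg_mem he), actSection_neg, actSection_extendByZero,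
      O.actSection_of_supp_subset_ker hf hk, add_neg_cancel]
  rw [hbot, TwoSidedIdeal.mem_bot, sub_eq_zero] at hmem
  have hmem : f = O.extendByZero (O.actSection f 1) := congrArg Subtype.val hmem
  rw [hmem]
  exact O.supp_extendByZero_subset _

end

/-! ### Nonzero ideals meet the diagonal. -/

section

variable {X : Type u} [Groupoid.{v} X] [TopologicalSpace X] [TopologicalSpace (Quiver.Total X)]
  [AmpleGroupoid X]

/-- Supplies the length for the induction in `exists_diagonalEmbedding_mem`. Only the supports of
the summands are recorded, as this is all that has to survive the induction step. -/
lemma exists_multiset_sum_eq (O : GroupoidSheafOfRings.{w} X)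
    {f : ∀ γ : Quiver.Total X, O.stalk γ.right} (hf : f ∈ O.convAlgebra) :
    ∃ m : Multiset O.convAlgebra, (∀ h ∈ m, ∃ U, IsCompactOpenBisection U ∧ O.supp h.1 ⊆ U) ∧
      m.sum.1 = f := by
  induction hf using AddSubgroup.closure_induction with
  | mem f hf =>
    obtain ⟨U, hU, -, hf⟩ := hf
    refine ⟨{⟨f, hf.mem_convAlgebra hU⟩}, ?_, by simp⟩
    simp only [Multiset.mem_singleton, forall_eq]
    exact ⟨U, hU, fun γ hγ => not_imp_comm.1 (hf.2 γ) hγ⟩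
  | zero => exact ⟨0, by simp, rfl⟩
  | add f g _ _ hf hg =>
    obtain ⟨m, hm, rfl⟩ := hf
    obtain ⟨m', hm', rfl⟩ := hg
    refine ⟨m + m', fun h hh => ?_, by simp⟩
    rcases Multiset.mem_add.1 hh with hh | hh
    · exact hm h hh
    · exact hm' h hh
  | neg f _ hf =>
    obtain ⟨m, hm, rfl⟩ := hf
    refine ⟨m.map (-·), fun h hh => ?_, by simp⟩
    obtain ⟨a, ha, rfl⟩ := Multiset.mem_map.1 hh
    obtain ⟨U, hU, hs⟩ := hm a ha
    exact ⟨U, hU, fun γ hγ => hs fun h0 => hγ (neg_eq_zero.2 h0)⟩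

lemma exists_mem_ne_zero_of_sum_ne_zero (O : GroupoidSheafOfRings.{w} X)
    {m : Multiset O.convAlgebra} {γ : Quiver.Total X} (h : m.sum.1 γ ≠ 0) :
    ∃ f ∈ m, f.1 γ ≠ 0 := by
  by_contra! h'
  refine h ?_
  induction m using Multiset.induction_on with
  | empty => rfl
  | cons a m ih =>
    have h1 : m.sum.1 γ = 0 := by
      by_contra h2
      exact h2 (ih h2 fun f hf => h' f (Multiset.mem_cons_of_mem hf))
    rw [Multiset.sum_cons]
    change a.1 γ + m.sum.1 γ = 0
    rw [h1, h' a (Multiset.mem_cons_self a m), add_zero]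

/-- If the diagonal is its own centralizer, every nonzero ideal meets the diagonal: an element of
the ideal with the least number of homogeneous terms, one of them diagonal, commutes with the
diagonal. -/
lemma exists_diagonalEmbedding_mem {O : GroupoidSheafOfRings.{w} X} (hO : O.IsSheafOfFields)
    (hmax : ∀ f ∈ O.convAlgebra, O.supp f ⊆ O.ker → O.supp f ⊆ unitArrows X)
    (I : TwoSidedIdeal O.convAlgebra) (m : Multiset O.convAlgebra)
    (hm : ∀ h ∈ m, ∃ U, IsCompactOpenBisection U ∧ O.supp h.1 ⊆ U) (hI : m.sum ∈ I)
    (h0 : m.sum ≠ 0) : ∃ s : O.diagonal, s ≠ 0 ∧ O.diagonalEmbedding s ∈ I := by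
  induction hn : m.card generalizing m with
  | zero => exact absurd (by rw [Multiset.card_eq_zero.1 hn, Multiset.sum_zero]) h0
  | succ n ih =>
    obtain ⟨γ, hγ⟩ : ∃ γ, m.sum.1 γ ≠ 0 := by
      by_contra! h
      exact h0 (Subtype.ext (funext h))
    obtain ⟨a, ham, haγ⟩ := O.exists_mem_ne_zero_of_sum_ne_zero hγ
    obtain ⟨U, hU, haU⟩ := hm a ham
    -- Right multiplication by the indicator of `U⁻¹` puts the summand `a` on the units and moves
    -- the value at `γ` to the unit at its range, so the product stays nonzero.
    let e : O.convAlgebra := ⟨_, O.indicatorArrows_mem hU.invArrows⟩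
    have hγe : (m.sum * e).1 ⟨γ.right, γ.right, 𝟙 γ.right⟩ ≠ 0 := by
      have := O.conv_indicatorArrows_invArrows m.sum.1 hU.range_injOn (haU haγ)
      exact fun h => hγ (this.symm.trans h)
    have hes : m.sum * e ≠ 0 := fun h => hγe (by rw [h]; rfl)
    by_cases hc : ∀ s : O.diagonal, O.diagonalEmbedding s * (m.sum * e) =
        (m.sum * e) * O.diagonalEmbedding s
    · have hu := hmax _ (m.sum * e).2 ((supp_subset_ker_iff hO _).2 fun s hs =>
        congrArg Subtype.val (hc ⟨s, hs⟩))
      have heq : m.sum * e = O.diagonalEmbedding ⟨_, O.actSection_one_mem (m.sum * e).2⟩ :=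
        Subtype.ext (O.eq_extendByZero_of_supp_subset hu)
      refine ⟨_, fun h => hes ?_, heq ▸ I.mul_mem_right _ _ hI⟩
      rw [heq, h, map_zero]
    · push Not at hc
      obtain ⟨s, hs⟩ := hc
      obtain ⟨t, rfl⟩ := Multiset.exists_cons_of_mem ham
      -- The commutator with `s` after multiplication by `e` is additive and kills `a`, so it sends
      -- the sum to a nonzero element of the ideal with one summand fewer.
      let c : O.convAlgebra → O.convAlgebra := fun x =>
        O.diagonalEmbedding s * (x * e) - x * e * O.diagonalEmbedding s
      have hca : c a = 0 := by
        refine sub_eq_zero.2 (Subtype.ext ?_)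
        exact (supp_subset_ker_iff hO _).1
          ((O.supp_conv_indicatorArrows_invArrows_subset hU haU).trans O.unitArrows_subset_ker)
          s.1 s.2
      have hct : (t.map c).sum = c (a ::ₘ t).sum := by
        rw [Multiset.sum_cons]
        have h1 : c (a + t.sum) = c a + c t.sum := by
          simp only [c, add_mul, mul_add]
          abel
        rw [h1, hca, zero_add]
        simp only [c, Multiset.sum_map_sub, Multiset.sum_map_mul_left, Multiset.sum_map_mul_right,
          Multiset.map_id']
      refine ih (t.map c) ?_ ?_ ?_ ?_
      · intro h hh
        obtain ⟨b, hb, rfl⟩ := Multiset.mem_map.1 hh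
        obtain ⟨V, hV, hbV⟩ := hm b (Multiset.mem_cons_of_mem hb)
        -- Commutators with diagonal elements do not enlarge supports, so the new summand is still
        -- carried by the bisection `V U⁻¹`.
        refine ⟨_, AmpleGroupoid.isCompactOpenBisection_mul hV hU.invArrows, fun δ hδ => ?_⟩
        refine O.supp_conv_subset (g := e.1) hbV
          (fun δ hδ => not_imp_comm.1 O.indicatorArrows_of_notMem hδ) fun h0 => hδ ?_
        change O.conv (O.extendByZero s.1) (O.conv b.1 e.1) δ -
          O.conv (O.conv b.1 e.1) (O.extendByZero s.1) δ = 0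
        rw [extendByZero_conv, conv_extendByZero, h0, mul_zero, zero_mul, sub_zero]
      · rw [hct]
        exact I.sub_mem (I.mul_mem_left _ _ (I.mul_mem_right _ _ hI))
          (I.mul_mem_right _ _ (I.mul_mem_right _ _ hI))
      · rw [hct]
        exact sub_ne_zero.2 hs
      · simpa using hn

/-- The diagonal contains local units: a generator supported on `U` is fixed by left multiplication
with the indicator of the range of `U`. -/
lemma eq_top_of_diagonalEmbedding_mem {O : GroupoidSheafOfRings.{w} X}
    {I : TwoSidedIdeal O.convAlgebra} (hI : ∀ s, O.diagonalEmbedding s ∈ I) : I = ⊤ := by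
  have key : ∀ f (hf : f ∈ O.convAlgebra), (⟨f, hf⟩ : O.convAlgebra) ∈ I := by
    intro f hf
    induction hf using AddSubgroup.closure_induction with
    | mem f hf' =>
      obtain ⟨U, hU, -, hf⟩ := hf'
      have hd := O.indicatorSection_mem
        (AmpleGroupoid.isLocalHomeomorph_range.isOpenMap _ hU.isOpen)
        (hU.isCompact.image AmpleGroupoid.continuous_range)
      refine (congrArg (· ∈ I) (Subtype.ext (funext fun γ => ?_))).mpr
        (I.mul_mem_right _ ⟨f, hf.mem_convAlgebra hU⟩ (hI ⟨_, hd⟩))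
      refine Eq.trans ?_ (O.extendByZero_conv _ f γ).symm
      change f γ = O.indicatorSection ((fun γ : Quiver.Total X => γ.right) '' U) γ.right * f γ
      by_cases hγ : γ ∈ U
      · have h : γ.right ∈ (fun γ : Quiver.Total X => γ.right) '' U := ⟨γ, hγ, rfl⟩
        rw [O.indicatorSection_of_mem h, one_mul]
      · rw [hf.2 γ hγ, mul_zero]
    | zero => exact I.zero_mem
    | add f g _ _ hf hg => exact I.add_mem hf hg
    | neg f _ hf => exact I.neg_mem hf
  exact top_le_iff.1 fun f _ => key f.1 f.2

lemma isInvariantIdeal_comap (O : GroupoidSheafOfRings.{w} X)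
    (I : TwoSidedIdeal O.convAlgebra) : O.IsInvariantIdeal (I.comap O.diagonalEmbedding) := by
  intro U hU s hs _
  rw [TwoSidedIdeal.mem_comap] at hs ⊢
  refine (congrArg (· ∈ I) (Subtype.ext (O.conv_transport hU s.1).symm)).mpr
    (I.mul_mem_right _ ⟨_, O.indicatorArrows_mem hU.invArrows⟩
      (I.mul_mem_left ⟨_, O.indicatorArrows_mem hU⟩ _ hs))

lemma isSimpleRing_of_isDiagonalSimple [Nonempty X] {O : GroupoidSheafOfRings.{w} X}
    (hO : O.IsSheafOfFields) (hD : O.IsDiagonalSimple)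
    (hmax : ∀ f ∈ O.convAlgebra, O.supp f ⊆ O.ker → O.supp f ⊆ unitArrows X) :
    IsSimpleRing O.convAlgebra := by
  have : Nontrivial O.convAlgebra := by
    obtain ⟨x⟩ := ‹Nonempty X›
    obtain ⟨U, hU, hxU, -⟩ := exists_isCompactOpenBisection isOpen_univ
      (Set.mem_univ (⟨x, x, 𝟙 x⟩ : Quiver.Total X))
    refine ⟨⟨⟨_, O.indicatorArrows_mem hU⟩, 0, fun h => ?_⟩⟩
    exact indicatorArrows_ne_zero hO hxU (congrFun (congrArg Subtype.val h) _)
  refine ⟨⟨fun I => or_iff_not_imp_left.2 fun hI => ?_⟩⟩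
  obtain ⟨f, hf, hf0⟩ : ∃ f ∈ I, f ≠ 0 := by
    by_contra! h
    exact hI (le_bot_iff.1 fun f hf => (TwoSidedIdeal.mem_bot _).2 (h f hf))
  obtain ⟨m, hm, hmf⟩ := O.exists_multiset_sum_eq f.2
  obtain rfl : m.sum = f := Subtype.ext hmf
  obtain ⟨s, hs, hsI⟩ := exists_diagonalEmbedding_mem hO hmax I m hm hf hf0
  have htop := (hD _ (O.isInvariantIdeal_comap I)).resolve_left fun h => by
    have := (TwoSidedIdeal.mem_comap _).2 hsI
    rw [h] at this
    exact hs ((TwoSidedIdeal.mem_bot _).1 this)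
  refine eq_top_of_diagonalEmbedding_mem fun s => (TwoSidedIdeal.mem_comap _).1 ?_
  rw [htop]
  trivial

/-! ### The Hausdorff case -/

/-- In a Hausdorff arrow space a compact open bisection is also closed, so extending by zero outside
it creates no discontinuity on its boundary. -/
lemma continuous_of_mem_convAlgebra [T2Space (Quiver.Total X)] (O : GroupoidSheafOfRings.{w} X)
    {f : ∀ γ : Quiver.Total X, O.stalk γ.right} (hf : f ∈ O.convAlgebra) :
    Continuous fun γ => (⟨γ.right, f γ⟩ : Σ x, O.stalk x) := by
  have h0 : Continuous fun γ : Quiver.Total X => (⟨γ.right, 0⟩ : Σ x, O.stalk x) :=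
    O.continuous_zero.comp AmpleGroupoid.continuous_range
  induction hf using AddSubgroup.closure_induction with
  | mem f hf =>
    obtain ⟨U, hU, -, hf⟩ := hf
    rw [continuous_iff_continuousAt]
    intro γ
    by_cases hγ : γ ∈ U
    · exact hf.1.continuousAt (hU.isOpen.mem_nhds hγ)
    · refine h0.continuousAt.congr ?_
      filter_upwards [hU.isCompact.isClosed.isOpen_compl.mem_nhds hγ] with δ hδ
      rw [hf.2 δ hδ]
  | zero => exact h0
  | add f g _ _ hf hg =>
    exact O.continuous_add.comp
      (f := fun γ : Quiver.Total X => (⟨γ.right, f γ, g γ⟩ : FiberPair O.stalk))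
      (isInducing_fiberPair.continuous_iff.2 (hf.prodMk hg))
  | neg f _ hf => exact O.continuous_neg.comp hf

lemma supp_subset_unitArrows_of_t2Space [T2Space (Quiver.Total X)]
    {O : GroupoidSheafOfRings.{w} X} (hO : O.IsSheafOfFields)
    (h : interior O.ker = unitArrows X) :
    ∀ f ∈ O.convAlgebra, O.supp f ⊆ O.ker → O.supp f ⊆ unitArrows X := by
  intro f hf hk
  rw [← h]
  exact interior_maximal hk (hO.isOpen_ne_zero.preimage (O.continuous_of_mem_convAlgebra hf))

end

end GroupoidSheafOfRings

/-! ### The equivalences. -/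

theorem mainTheorem5 {X : Type u} [Groupoid.{v} X] [TopologicalSpace X]
    [TopologicalSpace (Quiver.Total X)] [AmpleGroupoid X] [Nonempty X]
    (O : GroupoidSheafOfRings.{w} X) (hO : O.IsSheafOfFields) :
    List.TFAE
      [IsSimpleRing O.convAlgebra,
        O.IsDiagonalSimple ∧ O.IsDiagonalMaximalCommutative,
        IsMinimalGroupoid X ∧ interior O.ker = unitArrows X ∧
          (O.sectionsIn (interior O.ker) : Set (∀ γ : Quiver.Total X, O.stalk γ.right)) =
            {f | f ∈ O.convAlgebra ∧ O.supp f ⊆ O.ker}] ∧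
    (T2Space (Quiver.Total X) →
      List.TFAE
        [IsSimpleRing O.convAlgebra,
          O.IsDiagonalSimple ∧ O.IsDiagonalMaximalCommutative,
          IsMinimalGroupoid X ∧ interior O.ker = unitArrows X ∧
            (O.sectionsIn (interior O.ker) : Set (∀ γ : Quiver.Total X, O.stalk γ.right)) =
              {f | f ∈ O.convAlgebra ∧ O.supp f ⊆ O.ker},
          IsMinimalGroupoid X ∧ interior O.ker = unitArrows X]) := by
  -- Both the kernel conditions in 3 and maximal commutativity in 2 become property (B); the cycle
  -- is 1 → 3 → 2 → 1.
  rw [GroupoidSheafOfRings.interior_ker_eq_and_sectionsIn_eq_iff hO,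
    GroupoidSheafOfRings.isDiagonalMaximalCommutative_iff hO]
  have h12 := fun h : O.IsDiagonalSimple ∧
      ∀ f ∈ O.convAlgebra, O.supp f ⊆ O.ker → O.supp f ⊆ unitArrows X =>
    GroupoidSheafOfRings.isSimpleRing_of_isDiagonalSimple hO h.1 h.2
  have h23 := fun h : IsMinimalGroupoid X ∧
      ∀ f ∈ O.convAlgebra, O.supp f ⊆ O.ker → O.supp f ⊆ unitArrows X =>
    And.intro (GroupoidSheafOfRings.isDiagonalSimple_of_isMinimalGroupoid hO h.1) h.2
  have h31 := fun h : IsSimpleRing O.convAlgebra =>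
    And.intro (GroupoidSheafOfRings.isMinimalGroupoid_of_isSimpleRing hO h)
      (GroupoidSheafOfRings.supp_subset_unitArrows_of_isSimpleRing hO h)
  refine ⟨?_, fun _ => ?_⟩
  · tfae_have 2 → 1 := h12
    tfae_have 3 → 2 := h23
    tfae_have 1 → 3 := h31
    tfae_finish
  · tfae_have 2 → 1 := h12
    tfae_have 3 → 2 := h23
    tfae_have 1 → 3 := h31
    tfae_have 3 → 4 := fun h =>
      ⟨h.1, ((GroupoidSheafOfRings.interior_ker_eq_and_sectionsIn_eq_iff hO).2 h.2).1⟩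
    tfae_have 4 → 3 := fun h =>
      ⟨h.1, GroupoidSheafOfRings.supp_subset_unitArrows_of_t2Space hO h.2⟩
    tfae_finish
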